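/- Let $K$ be a locally compact, separable, metrizable space, $\mu$ a $\sigma$-finite Borel measure on $K$ with full support, and $(\mathcal E,\mathcal F)$ a symmetric regular Dirichlet form on the real space $L^2(K,\mu)$, where $\mathcal F$ carries the norm $\|f\|_{\mathcal F}=\mathcal E_1(f,f)^{1/2}$, $\mathcal E_1(f,g)=\mathcal E(f,g)+\int_K fg\,d\mu$. For bounded $f\in\mathcal F$, the energy measure $\nu_f$ is the finite Borel measure on $K$ with $\int_K\varphi\,d\nu_f=2\mathcal E(f\varphi,f)-\mathcal E(\varphi,f^2)$ for all $\varphi\in\mathcal F\cap C_0(K)$, where $C_0(K)$ is the set of continuous real functions with compact support; for general $f\in\mathcal F$, $\nu_f$ is the setwise limit of $\nu_{g_n}$ for bounded $g_n\in\mathcal F$ with $g_n\to f$ in $\mathcal F$. Put $\nu_{f,g}=\frac12(\nu_{f+g}-\nu_f-\nu_g)$. Let $\nu$ be a minimal energy-dominant measure of $(\mathcal E,\mathcal F)$, that is, a $\sigma$-finite Borel measure on $K$ such that $\nu_f\ll\nu$ for every $f\in\mathcal F$, and $\nu\ll\nu'$ for every $\sigma$-finite Borel measure $\nu'$ with the same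 property. The pointwise index of $(\mathcal E,\mathcal F)$ is the ($\nu$-a.e. unique) measurable function $p(\cdot)\colon K\to\{0,1,2,\dots\}\cup\{+\infty\}$ such that (a) for all $N$ and all $g_1,\dots,g_N\in\mathcal F$, $\operatorname{rank}\bigl(\frac{d\nu_{g_i,g_j}}{d\nu}(x)\bigr)_{i,j=1}^N\le p(x)$ for $\nu$-a.e. $x$, and (b) if another function $p'(\cdot)$ satisfies (a) in place of $p(\cdot)$, then $p(x)\le p'(x)$ for $\nu$-a.e. $x$. The index of $(\mathcal E,\mathcal F)$ is the $\nu$-essential supremum of $p(\cdot)$. Let $\{f_i\}_{i=1}^\infty$ be a sequence in $\mathcal F$ whose linear span is dense in $\mathcal F$, let $Z^{i,j}$ be a version of the Radon–Nikodym derivative $d\nu_{f_i,f_j}/d\nu$ for $i,j\ge1$, and let $p$ be a nonnegative integer. Then the index of $(\mathcal E,\mathcal F)$ is at most $p$ if and only if there exists a sequence $\{\zeta^i\}_{i=1}^\infty$ of $\mathbb R^p$-valued Borel measurable functions on $K$ such that, for $\nu$-a.e. $x\in K$, $$Z^{i,j}(x)=(\zeta^i(x),\zeta^j(x))_{\mathbb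 R^p}\quad\text{for all } i,j\ge1,$$ and $\zeta^j_k(x)=0$ for all $j\ge1$ and all $k\in\{1,\dots,p\}$ with $k>p(x)$, where $\zeta^j(x)=(\zeta^j_1(x),\dots,\zeta^j_p(x))$. -/

import Mathlib

open MeasureTheory Filter Topology

noncomputable section

/-- The form `ℰ₁(f, g) = ℰ(f, g) + ∫ f g dμ` on the domain `D ⊆ L²(K, μ)`; the second summand is the
inner product of `L²(K, μ)`. -/
def formOne {K : Type*} [MeasurableSpace K] {μ : Measure K} {D : Submodule ℝ (Lp ℝ 2 μ)}
    (B : LinearMap.BilinForm ℝ D) (f g : D) : ℝ :=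
  B f g + inner ℝ (f : Lp ℝ 2 μ) (g : Lp ℝ 2 μ)

/-- A symmetric regular Dirichlet form `(ℰ, ℱ)` on the real space `L²(K, μ)`. -/
structure RegularDirichletForm {K : Type*} [TopologicalSpace K] [MeasurableSpace K]
    (μ : Measure K) where
  /-- The domain `ℱ`. -/
  domain : Submodule ℝ (Lp ℝ 2 μ)
  /-- The bilinear form `ℰ`. -/
  form : LinearMap.BilinForm ℝ domain
  dense_domain : Dense (domain : Set (Lp ℝ 2 μ))
  form_comm : ∀ f g : domain, form f g = form g f
  form_nonneg : ∀ f : domain, 0 ≤ form f f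
  /-- Closedness: `ℱ` is complete for `ℰ₁`. -/
  closed : ∀ u : ℕ → domain,
    (∀ ε : ℝ, 0 < ε → ∃ n : ℕ, ∀ i ≥ n, ∀ j ≥ n, formOne form (u i - u j) (u i - u j) < ε) →
    ∃ f : domain, Tendsto (fun i => formOne form (u i - f) (u i - f)) atTop (𝓝 0)
  /-- Markov property: the unit contraction operates on `ℱ`. -/
  markov : ∀ f : domain, ∃ g : domain,
    (∀ᵐ x ∂μ, (g : Lp ℝ 2 μ) x = min (max 0 ((f : Lp ℝ 2 μ) x)) 1) ∧ form g g ≤ form f f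
  /-- Regularity, first half: `ℱ ∩ C₀(K)` is dense in `ℱ`. -/
  regular_domain : ∀ f : domain, ∀ ε : ℝ, 0 < ε →
    ∃ (g : domain) (φ : CompactlySupportedContinuousMap K ℝ),
      (∀ᵐ x ∂μ, (g : Lp ℝ 2 μ) x = φ x) ∧ formOne form (f - g) (f - g) < ε
  /-- Regularity, second half: `ℱ ∩ C₀(K)` is uniformly dense in `C₀(K)`, the space of continuous
  functions with compact support. -/
  regular_continuous : ∀ ψ : CompactlySupportedContinuousMap K ℝ, ∀ ε : ℝ, 0 < ε →
    ∃ (g : domain) (φ : CompactlySupportedContinuousMap K ℝ),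
      (∀ᵐ x ∂μ, (g : Lp ℝ 2 μ) x = φ x) ∧ ∀ x, |ψ x - φ x| < ε

namespace RegularDirichletForm

variable {K : Type*} [TopologicalSpace K] [MeasurableSpace K] {μ : Measure K}

/-- `f ∈ ℱ` is bounded and `m` is its energy measure: `m` is a finite Borel measure with
`∫ φ dm = 2 ℰ(f φ, f) - ℰ(φ, f²)` for all `φ ∈ ℱ ∩ C₀(K)`.
Here `s` is the element `f²` of `ℱ` and `u` is the element `f φ` of `ℱ`. -/
structure IsBoundedEnergyMeasure (E : RegularDirichletForm μ) (f : E.domain) (m : Measure K) :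
    Prop where
  finite : IsFiniteMeasure m
  bounded : ∃ C : ℝ, ∀ᵐ x ∂μ, |(f : Lp ℝ 2 μ) x| ≤ C
  identity : ∃ s : E.domain, (∀ᵐ x ∂μ, (s : Lp ℝ 2 μ) x = (f : Lp ℝ 2 μ) x ^ 2) ∧
    ∀ (g : E.domain) (φ : CompactlySupportedContinuousMap K ℝ),
      (∀ᵐ x ∂μ, (g : Lp ℝ 2 μ) x = φ x) →
      ∃ u : E.domain, (∀ᵐ x ∂μ, (u : Lp ℝ 2 μ) x = (f : Lp ℝ 2 μ) x * φ x) ∧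
        ∫ x, φ x ∂m = 2 * E.form u f - E.form g s

/-- `m` is the energy measure of `f ∈ ℱ`: it is the setwise limit of the energy measures of a
sequence of bounded functions that converges to `f` in `ℱ`. (The limit does not depend on the
sequence; for a bounded `f` the constant sequence gives back the defining identity.) -/
def IsEnergyMeasure (E : RegularDirichletForm μ) (f : E.domain) (m : Measure K) : Prop :=
  IsFiniteMeasure m ∧ ∃ (g : ℕ → E.domain) (mg : ℕ → Measure K),
    (∀ n, E.IsBoundedEnergyMeasure (g n) (mg n)) ∧
    Tendsto (fun n => formOne E.form (g n - f) (g n - f)) atTop (𝓝 0) ∧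
    ∀ B, MeasurableSet B → Tendsto (fun n => mg n B) atTop (𝓝 (m B))

open Classical in
/-- The energy measure `ν_f` of `f ∈ ℱ`. -/
def energyMeasure (E : RegularDirichletForm μ) (f : E.domain) : Measure K :=
  if h : ∃ m, E.IsEnergyMeasure f m then h.choose else 0

instance (E : RegularDirichletForm μ) (f : E.domain) : IsFiniteMeasure (E.energyMeasure f) := by
  unfold energyMeasure
  split_ifs with h
  · exact h.choose_spec.1
  · infer_instance

/-- The mutual energy measure `ν_{f,g} = (ν_{f+g} - ν_f - ν_g) / 2`, a signed measure. -/
def mutualEnergyMeasure (E : RegularDirichletForm μ) (f g : E.domain) : SignedMeasure K :=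
  (1 / 2 : ℝ) • ((E.energyMeasure (f + g)).toSignedMeasure - (E.energyMeasure f).toSignedMeasure
    - (E.energyMeasure g).toSignedMeasure)

/-- `ν` is a minimal energy-dominant measure. -/
structure IsMinimalEnergyDominant (E : RegularDirichletForm μ) (ν : Measure K) : Prop where
  sigmaFinite : SigmaFinite ν
  domination : ∀ f : E.domain, E.energyMeasure f ≪ ν
  minimality : ∀ ν' : Measure K, SigmaFinite ν' → (∀ f : E.domain, E.energyMeasure f ≪ ν') →
    ν ≪ ν'

/-- For all `f₁, …, f_N ∈ ℱ`, the rank of the matrix of densities `dν_{fᵢ,fⱼ}/dν` at `x` is at most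
`q x`, for `ν`-a.e. `x`. -/
def BoundsRank (E : RegularDirichletForm μ) (ν : Measure K) (q : K → ℕ∞) : Prop :=
  ∀ (N : ℕ) (f : Fin N → E.domain), ∀ᵐ x ∂ν,
    ((Matrix.of fun i j => (E.mutualEnergyMeasure (f i) (f j)).rnDeriv ν x).rank : ℕ∞) ≤ q x

/-- `q` is (a version of) the pointwise index: the `ν`-a.e. smallest measurable function that
satisfies the rank bound. -/
structure IsPointwiseIndex (E : RegularDirichletForm μ) (ν : Measure K) (q : K → ℕ∞) : Prop where
  measurable : Measurable q
  boundsRank : E.BoundsRank ν q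
  minimal : ∀ q' : K → ℕ∞, E.BoundsRank ν q' → ∀ᵐ x ∂ν, q x ≤ q' x

open Classical in
/-- The pointwise index `p(x)`, which is determined `ν`-a.e. -/
def pointwiseIndex (E : RegularDirichletForm μ) (ν : Measure K) : K → ℕ∞ :=
  if h : ∃ q, E.IsPointwiseIndex ν q then h.choose else 0

/-- The index: the `ν`-essential supremum of the pointwise index. -/
def index (E : RegularDirichletForm μ) (ν : Measure K) : ℕ∞ :=
  essSup (E.pointwiseIndex ν) ν

/-- The linear span of the sequence `f` is dense in `ℱ`, with respect to `ℰ₁`. -/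
def HasDenseSpan (E : RegularDirichletForm μ) (f : ℕ → E.domain) : Prop :=
  ∀ g : E.domain, ∀ ε : ℝ, 0 < ε → ∃ h ∈ Submodule.span ℝ (Set.range f),
    formOne E.form (g - h) (g - h) < ε

end RegularDirichletForm

end

/-! Once the densities `Z` are known to form a positive semidefinite kernel at almost every point,
the theorem is pointwise linear algebra. If all leading sections of such a kernel have rank at most
`p`, pivoted Cholesky elimination stops after at most `p` steps and writes the kernel as a Gram
matrix of vectors in `ℝ^p`; the column of step `m` (counted from 0) vanishes as soon as the ranks
are at most `m`. Always taking the first admissible pivot makes the factor measurable in `x`.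
Conversely a Gram matrix of vectors in `ℝ^p` has rank at most `p` (`eq_sum_factor`,
`factor_eq_zero`, `rank_gram_le`).

The link with the index is `pointwiseIndex_ae_eq_rankSup`: the pointwise index is the supremum of
the ranks of the leading sections of the given sequence. Elements of the span give matrices `A Z Aᵀ`
of no larger rank. General elements of `ℱ` are approximated so fast that the densities converge
almost everywhere, and rank bounds survive limits because rank is lower semicontinuous.

All this needs `ν_{f,g}` to be bilinear and positive, hence the existence and uniqueness of energy
measures. The operators `(n+1) G_{n+1}` built from the resolvent are symmetric and sub-Markov, so
their carré du champ is nonnegative. Integrating it against `ψ ∈ C_c`, rescaling by `n + 1` and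
passing to a limit along a free ultrafilter gives a positive functional bounded by `2 ‖ψ‖_∞ ℰ(f,
f)`, which the Riesz–Markov theorem represents by a measure. For bounded `f` it satisfies the
defining identity, regularity gives uniqueness, and Cauchy–Schwarz extends the identification to all
of `ℱ` (`energyMeasure_eq_champMeasure`). -/

set_option linter.unusedSectionVars false

/-! ### Symmetric sub-Markov operators on L² and their carré du champ -/

noncomputable section

open scoped ENNReal

/-- Symmetric operators on `L²` that map functions with values in `[0, 1]` to such functions. -/
structure IsSubMarkov {K : Type*} [MeasurableSpace K] {μ : Measure K}
    (T : Lp ℝ 2 μ →L[ℝ] Lp ℝ 2 μ) : Prop where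
  symm : ∀ f g, inner ℝ (T f) g = inner ℝ f (T g)
  unit : ∀ h : Lp ℝ 2 μ, (∀ᵐ x ∂μ, 0 ≤ h x ∧ h x ≤ 1) → ∀ᵐ x ∂μ, 0 ≤ T h x ∧ T h x ≤ 1

section L2

variable {K : Type*} [MeasurableSpace K] {μ : Measure K}

/-- A function in `L²` that is essentially bounded. -/
def IsBdd (f : Lp ℝ 2 μ) : Prop := ∃ C : ℝ, ∀ᵐ x ∂μ, |f x| ≤ C

lemma IsBdd.exists_pos {f : Lp ℝ 2 μ} (hf : IsBdd f) : ∃ C : ℝ, 0 < C ∧ ∀ᵐ x ∂μ, |f x| ≤ C := by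
  obtain ⟨C, hC⟩ := hf
  refine ⟨max C 1, lt_max_of_lt_right one_pos, ?_⟩
  filter_upwards [hC] with x hx using hx.trans (le_max_left _ _)

lemma IsBdd.add {f g : Lp ℝ 2 μ} (hf : IsBdd f) (hg : IsBdd g) : IsBdd (f + g) := by
  obtain ⟨C, hC⟩ := hf
  obtain ⟨D, hD⟩ := hg
  refine ⟨C + D, ?_⟩
  filter_upwards [hC, hD, Lp.coeFn_add f g] with x h1 h2 h3
  rw [h3]
  exact (abs_add_le _ _).trans (add_le_add h1 h2)

lemma inner_L2_eq (f g : Lp ℝ 2 μ) : inner ℝ f g = ∫ x, f x * g x ∂μ := by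
  rw [L2.inner_def]
  refine integral_congr_ae (.of_forall fun x => ?_)
  simp [mul_comm]

lemma integrable_L2_mul (f g : Lp ℝ 2 μ) : Integrable (fun x => f x * g x) μ :=
  (Lp.memLp f).integrable_mul (Lp.memLp g)

lemma integrable_bdd_mul {φ : Lp ℝ 2 μ} (hφ : IsBdd φ) {h : K → ℝ} (hh : Integrable h μ) :
    Integrable (fun x => φ x * h x) μ := by
  obtain ⟨C, hC⟩ := hφ
  exact hh.bdd_mul (c := C) (Lp.aestronglyMeasurable φ) (by simpa using hC)

lemma exists_mul_L2 {φ : Lp ℝ 2 μ} (hφ : IsBdd φ) (f : Lp ℝ 2 μ) :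
    ∃ u : Lp ℝ 2 μ, ∀ᵐ x ∂μ, u x = φ x * f x := by
  obtain ⟨C, hC⟩ := hφ
  have : MemLp (fun x => φ x * f x) 2 μ := by
    refine (Lp.memLp f).of_le_mul (c := C)
      ((Lp.aestronglyMeasurable φ).mul (Lp.aestronglyMeasurable f)) ?_
    filter_upwards [hC] with x hx
    rw [norm_mul]
    exact mul_le_mul_of_nonneg_right hx (norm_nonneg _)
  exact ⟨this.toLp _, this.coeFn_toLp⟩

lemma IsBdd.of_mul {φ f u : Lp ℝ 2 μ} (hφ : IsBdd φ) (hf : IsBdd f)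
    (hu : ∀ᵐ x ∂μ, u x = φ x * f x) : IsBdd u := by
  obtain ⟨C, hC0, hC⟩ := hφ.exists_pos
  obtain ⟨D, hD⟩ := hf
  refine ⟨C * D, ?_⟩
  filter_upwards [hC, hD, hu] with x h1 h2 h3
  rw [h3, abs_mul]
  exact mul_le_mul h1 h2 (abs_nonneg _) hC0.le

/-- Multiplication by a bounded function, as an operator on `L²`. -/
lemma exists_mulOp {φ : Lp ℝ 2 μ} (hφ : IsBdd φ) :
    ∃ M : Lp ℝ 2 μ →L[ℝ] Lp ℝ 2 μ, ∀ f g, inner ℝ (M f) g = ∫ x, φ x * (f x * g x) ∂μ := by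
  obtain ⟨C, hC⟩ := hφ
  have hw : MemLp φ ∞ μ := memLp_top_of_bound (Lp.aestronglyMeasurable φ) C (by simpa using hC)
  refine ⟨(ContinuousLinearMap.mul ℝ ℝ).holderL μ ∞ 2 2 (hw.toLp _), fun f g => ?_⟩
  rw [inner_L2_eq]
  refine integral_congr_ae ?_
  filter_upwards [(ContinuousLinearMap.mul ℝ ℝ).coeFn_holder (r := 2) (hw.toLp _) f,
    hw.coeFn_toLp] with x h1 h2
  simp only [ContinuousLinearMap.holderL_apply_apply]
  rw [h1]
  simp [h2, mul_assoc]

/-- Bounded functions are dense in `L²`. -/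
lemma bdd_induction {P : Lp ℝ 2 μ → Prop} (hc : IsClosed {f | P f})
    (hb : ∀ f, IsBdd f → P f) (f : Lp ℝ 2 μ) : P f := by
  refine (Lp.simpleFunc.denseRange (E := ℝ) (μ := μ) (p := 2) (by simp)).induction_on f hc ?_
  intro g
  apply hb
  obtain ⟨C, hC⟩ := (Lp.simpleFunc.toSimpleFunc g).exists_forall_norm_le
  refine ⟨C, ?_⟩
  filter_upwards [Lp.simpleFunc.toSimpleFunc_eq_toFun g] with x hx
  rw [← hx]
  exact hC x

end L2

namespace IsSubMarkov

variable {K : Type*} [MeasurableSpace K] {μ : Measure K} {T : Lp ℝ 2 μ →L[ℝ] Lp ℝ 2 μ}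

lemma map_bdd_nonneg (hT : IsSubMarkov T) {h : Lp ℝ 2 μ} {C : ℝ} (hC : 0 < C)
    (h0 : ∀ᵐ x ∂μ, 0 ≤ h x ∧ h x ≤ C) : ∀ᵐ x ∂μ, 0 ≤ T h x ∧ T h x ≤ C := by
  have h1 : ∀ᵐ x ∂μ, 0 ≤ (C⁻¹ • h : Lp ℝ 2 μ) x ∧ (C⁻¹ • h : Lp ℝ 2 μ) x ≤ 1 := by
    filter_upwards [h0, Lp.coeFn_smul C⁻¹ h] with x hx hs
    rw [hs, Pi.smul_apply, smul_eq_mul]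
    refine ⟨mul_nonneg (inv_nonneg.2 hC.le) hx.1, ?_⟩
    rw [inv_mul_le_iff₀ hC]
    linarith [hx.2]
  have h2 := hT.unit _ h1
  rw [map_smul] at h2
  filter_upwards [h2, Lp.coeFn_smul C⁻¹ (T h)] with x hx hs
  rw [hs, Pi.smul_apply, smul_eq_mul] at hx
  refine ⟨?_, ?_⟩
  · by_contra hn
    push Not at hn
    have := mul_neg_of_pos_of_neg (inv_pos.2 hC) hn
    linarith [hx.1]
  · have := hx.2
    rw [inv_mul_le_iff₀ hC] at this
    linarith

/-- Nonnegative simple functions are bounded, so rescaling reduces them to the unit interval, and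
they are dense in the closed cone of nonnegative elements of L². -/
lemma map_nonneg (hT : IsSubMarkov T) {h : Lp ℝ 2 μ} (h0 : 0 ≤ h) : 0 ≤ T h := by
  have hd := Lp.simpleFunc.denseRange_coeSimpleFuncNonnegToLpNonneg (G := ℝ) (p := 2) (μ := μ)
    (by simp)
  have hclosed : IsClosed {g : { g : Lp ℝ 2 μ // 0 ≤ g } | 0 ≤ T g} :=
    isClosed_le continuous_const (T.continuous.comp continuous_subtype_val)
  refine hd.induction_on (p := fun g => 0 ≤ T g) (⟨h, h0⟩ : { g : Lp ℝ 2 μ // 0 ≤ g })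
    hclosed ?_
  intro g
  obtain ⟨C, hC⟩ := (Lp.simpleFunc.toSimpleFunc g.1).exists_forall_norm_le
  have hg : (0 : Lp ℝ 2 μ) ≤ (g.1 : Lp ℝ 2 μ) := g.2
  rw [← Lp.coeFn_nonneg] at hg
  have := hT.map_bdd_nonneg (h := (g.1 : Lp ℝ 2 μ)) (C := max C 1)
    (lt_max_of_lt_right one_pos) (by
      filter_upwards [hg, Lp.simpleFunc.toSimpleFunc_eq_toFun g.1] with x hx hs
      refine ⟨hx, ?_⟩
      rw [← hs]
      exact (le_abs_self _).trans ((hC x).trans (le_max_left _ _)))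
  rw [← Lp.coeFn_nonneg]
  filter_upwards [this] with x hx using hx.1

lemma ae_nonneg (hT : IsSubMarkov T) {h : Lp ℝ 2 μ} (h0 : ∀ᵐ x ∂μ, 0 ≤ h x) :
    ∀ᵐ x ∂μ, 0 ≤ T h x := by
  have : 0 ≤ T h := hT.map_nonneg ((Lp.coeFn_nonneg h).1 h0)
  exact (Lp.coeFn_nonneg _).2 this

/-- Constants need not lie in L², so `h` is compared with its positive part, which takes values in
`[0, c]`. This one-sided bound turns pointwise polynomial inequalities into inequalities for `T`. -/
lemma ae_le_const (hT : IsSubMarkov T) {h : Lp ℝ 2 μ} {c : ℝ} (hc : 0 ≤ c)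
    (h0 : ∀ᵐ x ∂μ, h x ≤ c) : ∀ᵐ x ∂μ, T h x ≤ c := by
  rcases hc.eq_or_lt with rfl | hc
  · have := hT.ae_nonneg (h := -h) (by
      filter_upwards [h0, Lp.coeFn_neg h] with x hx hn
      rw [hn, Pi.neg_apply]; linarith)
    rw [map_neg] at this
    filter_upwards [this, Lp.coeFn_neg (T h)] with x hx hn
    rw [hn, Pi.neg_apply] at hx; linarith
  · have hp := hT.map_bdd_nonneg (h := h ⊔ 0) hc (by
      filter_upwards [h0, Lp.coeFn_sup h 0, Lp.coeFn_zero ℝ 2 μ] with x hx hs hz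
      rw [hs, Pi.sup_apply, hz]
      exact ⟨le_sup_right, sup_le hx hc.le⟩)
    have hd := hT.map_nonneg (h := h ⊔ 0 - h) (sub_nonneg.2 le_sup_left)
    rw [map_sub, sub_nonneg, ← Lp.coeFn_le] at hd
    filter_upwards [hp, hd] with x h1 h2 using h2.trans h1.2

lemma isBdd_map (hT : IsSubMarkov T) {h : Lp ℝ 2 μ} (hh : IsBdd h) : IsBdd (T h) := by
  obtain ⟨C, hC0, hC⟩ := hh.exists_pos
  refine ⟨C, ?_⟩
  have h1 := hT.ae_le_const (h := h) hC0.le (by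
    filter_upwards [hC] with x hx using (le_abs_self _).trans hx)
  have h2 := hT.ae_le_const (h := -h) hC0.le (by
    filter_upwards [hC, Lp.coeFn_neg h] with x hx hn
    rw [hn, Pi.neg_apply]; exact (neg_le_abs _).trans hx)
  rw [map_neg] at h2
  filter_upwards [h1, h2, Lp.coeFn_neg (T h)] with x h1 h2 hn
  rw [hn, Pi.neg_apply] at h2
  exact abs_le.2 ⟨by linarith, h1⟩

/-- Pointwise nonnegativity of `f² - 2 f T f + T (f²)`. -/
lemma carre_du_champ_nonneg (hT : IsSubMarkov T) {f s : Lp ℝ 2 μ}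
    (hs : ∀ᵐ x ∂μ, s x = f x ^ 2) : ∀ᵐ x ∂μ, 0 ≤ f x ^ 2 - 2 * (f x * T f x) + T s x := by
  -- This is `T` applied to `2 c f - f² ≤ c²`. Rational `c` keep the exceptional set null;
  -- continuity in `c` then allows the choice `c = f x`.
  have key : ∀ c : ℚ, ∀ᵐ x ∂μ, 2 * (c : ℝ) * T f x - T s x ≤ (c : ℝ) ^ 2 := by
    intro c
    have h1 := hT.ae_le_const (h := (2 * (c : ℝ)) • f - s) (sq_nonneg (c : ℝ)) (by
      filter_upwards [hs, Lp.coeFn_sub ((2 * (c : ℝ)) • f) s, Lp.coeFn_smul (2 * (c : ℝ)) f]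
        with x h1 h2 h3
      rw [h2, Pi.sub_apply, h3, Pi.smul_apply, smul_eq_mul, h1]
      nlinarith [sq_nonneg (f x - c)])
    rw [map_sub, map_smul] at h1
    filter_upwards [h1, Lp.coeFn_sub ((2 * (c : ℝ)) • T f) (T s),
      Lp.coeFn_smul (2 * (c : ℝ)) (T f)] with x h1 h2 h3
    rwa [h2, Pi.sub_apply, h3, Pi.smul_apply, smul_eq_mul] at h1
  filter_upwards [ae_all_iff.2 key] with x hx
  have : ∀ c : ℝ, 2 * c * T f x - T s x ≤ c ^ 2 := fun c =>
    Rat.denseRange_cast.induction_on (p := fun c : ℝ => 2 * c * T f x - T s x ≤ c ^ 2) c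
      (isClosed_le (by fun_prop) (by fun_prop)) hx
  nlinarith [this (f x)]

/-- The squaring map decreases `f² - 2 f T f + T (f²)`, up to a factor. -/
lemma carre_du_champ_sq_le (hT : IsSubMarkov T) {f s r : Lp ℝ 2 μ} {M : ℝ} (hM0 : 0 ≤ M)
    (hM : ∀ᵐ x ∂μ, |f x| ≤ M) (hs : ∀ᵐ x ∂μ, s x = f x ^ 2) (hr : ∀ᵐ x ∂μ, r x = s x ^ 2) :
    ∀ᵐ x ∂μ, s x ^ 2 - 2 * (s x * T s x) + T r x ≤
      4 * M ^ 2 * (f x ^ 2 - 2 * (f x * T f x) + T s x) := by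
  -- The source is `(f² - c²)² ≤ (M + |c|)² (f - c)²`, with the constant terms moved to the right.
  -- At `c = f x` the factor is at most `(2 M)²`.
  have key : ∀ c : ℚ, ∀ᵐ x ∂μ, T r x - (2 * (c : ℝ) ^ 2 + (M + |(c : ℝ)|) ^ 2) * T s x
      + (2 * (M + |(c : ℝ)|) ^ 2 * c) * T f x ≤ (M + |(c : ℝ)|) ^ 2 * (c : ℝ) ^ 2 - (c : ℝ) ^ 4 := by
    intro c
    set L := (M + |(c : ℝ)|) ^ 2 with hL
    have hLc : (c : ℝ) ^ 2 ≤ L := by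
      rw [hL, ← sq_abs (c : ℝ)]
      exact pow_le_pow_left₀ (abs_nonneg _) (by linarith) 2
    have h1 := hT.ae_le_const (h := r - (2 * (c : ℝ) ^ 2 + L) • s + (2 * L * c) • f)
      (c := L * (c : ℝ) ^ 2 - (c : ℝ) ^ 4) (by nlinarith [sq_nonneg (c : ℝ)]) (by
      filter_upwards [hM, hs, hr, Lp.coeFn_add (r - (2 * (c : ℝ) ^ 2 + L) • s) ((2 * L * c) • f),
        Lp.coeFn_sub r ((2 * (c : ℝ) ^ 2 + L) • s),
        Lp.coeFn_smul (2 * (c : ℝ) ^ 2 + L) s, Lp.coeFn_smul (2 * L * (c : ℝ)) f]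
        with x hMx h1 h2 h3 h4 h5 h6
      rw [h3, Pi.add_apply, h4, Pi.sub_apply, h5, h6, Pi.smul_apply, Pi.smul_apply, smul_eq_mul,
        smul_eq_mul, h2, h1]
      have h7 : (f x + c) ^ 2 ≤ L := by
        rw [hL, ← sq_abs (f x + c)]
        exact pow_le_pow_left₀ (abs_nonneg _) ((abs_add_le _ _).trans (by linarith)) 2
      nlinarith [mul_le_mul_of_nonneg_right h7 (sq_nonneg (f x - c))])
    rw [map_add, map_sub, map_smul, map_smul] at h1
    filter_upwards [h1, Lp.coeFn_add (T r - (2 * (c : ℝ) ^ 2 + L) • T s) ((2 * L * c) • T f),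
        Lp.coeFn_sub (T r) ((2 * (c : ℝ) ^ 2 + L) • T s),
        Lp.coeFn_smul (2 * (c : ℝ) ^ 2 + L) (T s), Lp.coeFn_smul (2 * L * (c : ℝ)) (T f)]
        with x h1 h3 h4 h5 h6
    rwa [h3, Pi.add_apply, h4, Pi.sub_apply, h5, h6, Pi.smul_apply, Pi.smul_apply, smul_eq_mul,
        smul_eq_mul] at h1
  filter_upwards [ae_all_iff.2 key, hM, hs, hT.carre_du_champ_nonneg hs] with x hx hMx hsx hG
  have := Rat.denseRange_cast.induction_on
    (p := fun c : ℝ => T r x - (2 * c ^ 2 + (M + |c|) ^ 2) * T s x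
      + (2 * (M + |c|) ^ 2 * c) * T f x ≤ (M + |c|) ^ 2 * c ^ 2 - c ^ 4) (f x)
      (isClosed_le (by fun_prop) (by fun_prop)) hx
  have h4 : (M + |f x|) ^ 2 ≤ 4 * M ^ 2 := by nlinarith [abs_nonneg (f x)]
  have h5 := mul_le_mul_of_nonneg_right h4 hG
  rw [hsx]
  nlinarith

/-- A sub-Markov operator maps nonnegative integrable functions to such functions, and does not
increase the integral. -/
lemma integrable_map [SigmaFinite μ] (hT : IsSubMarkov T) {h : Lp ℝ 2 μ}
    (h0 : ∀ᵐ x ∂μ, 0 ≤ h x) (hi : Integrable h μ) :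
    Integrable (T h) μ ∧ ∫ x, T h x ∂μ ≤ ∫ x, h x ∂μ := by
  have hT0 := hT.ae_nonneg h0
  -- By symmetry `∫_S T h = ⟨T 1_S, h⟩`, and `T 1_S ≤ 1`; the sets `S` of finite measure then
  -- exhaust the space.
  have hb : ∀ n, ∫⁻ x in spanningSets μ n, ENNReal.ofReal (T h x) ∂μ
      ≤ ENNReal.ofReal (∫ x, h x ∂μ) := by
    intro n
    have hm := measurableSet_spanningSets μ n
    have hfin := (measure_spanningSets_lt_top μ n).ne
    set χ : Lp ℝ 2 μ := indicatorConstLp 2 hm hfin (1 : ℝ) with hχ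
    have hχe : ∀ᵐ x ∂μ, χ x = (spanningSets μ n).indicator (fun _ => (1 : ℝ)) x :=
      indicatorConstLp_coeFn
    have e1 : inner ℝ χ (T h) = ∫ x in spanningSets μ n, T h x ∂μ := by
      rw [inner_L2_eq, ← integral_indicator hm]
      refine integral_congr_ae ?_
      filter_upwards [hχe] with x hx
      rw [hx]
      by_cases hxs : x ∈ spanningSets μ n <;> simp [hxs]
    have hio : IntegrableOn (T h) (spanningSets μ n) μ := by
      have := integrable_L2_mul χ (T h)
      rw [← integrable_indicator_iff hm]
      refine this.congr ?_
      filter_upwards [hχe] with x hx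
      rw [hx]
      by_cases hxs : x ∈ spanningSets μ n <;> simp [hxs]
    rw [← ofReal_integral_eq_lintegral_ofReal hio (ae_restrict_of_ae hT0), ← e1, ← hT.symm,
      inner_L2_eq]
    refine ENNReal.ofReal_le_ofReal (integral_mono_ae (integrable_L2_mul _ _) hi ?_)
    have hχT := hT.unit χ (by
      filter_upwards [hχe] with x hx
      rw [hx]
      by_cases hxs : x ∈ spanningSets μ n <;> simp [hxs])
    filter_upwards [hχT, h0] with x h1 h2
    exact mul_le_of_le_one_left h2 h1.2
  have hle : ∫⁻ x, ENNReal.ofReal (T h x) ∂μ ≤ ENNReal.ofReal (∫ x, h x ∂μ) := by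
    rw [← setLIntegral_univ, ← iUnion_spanningSets μ,
      setLIntegral_iUnion_of_directed _ (monotone_spanningSets μ).directed_le]
    exact iSup_le hb
  have hint : Integrable (T h) μ := by
    refine ⟨Lp.aestronglyMeasurable _, ?_⟩
    rw [hasFiniteIntegral_iff_ofReal hT0]
    exact hle.trans_lt ENNReal.ofReal_lt_top
  refine ⟨hint, ?_⟩
  rw [← ofReal_integral_eq_lintegral_ofReal hint hT0] at hle
  exact (ENNReal.ofReal_le_ofReal_iff (integral_nonneg_of_ae h0)).1 hle

lemma integrable_sq_of {f s : Lp ℝ 2 μ} (hs : ∀ᵐ x ∂μ, s x = f x ^ 2) : Integrable s μ := by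
  refine (integrable_L2_mul f f).congr ?_
  filter_upwards [hs] with x hx
  rw [hx, sq]

lemma integral_sq_eq {f s : Lp ℝ 2 μ} (hs : ∀ᵐ x ∂μ, s x = f x ^ 2) :
    ∫ x, s x ∂μ = inner ℝ f f := by
  rw [inner_L2_eq]
  refine integral_congr_ae ?_
  filter_upwards [hs] with x hx
  rw [hx, sq]

lemma integrable_carre_du_champ [SigmaFinite μ] (hT : IsSubMarkov T) {f s : Lp ℝ 2 μ}
    (hs : ∀ᵐ x ∂μ, s x = f x ^ 2) :
    Integrable (fun x => f x ^ 2 - 2 * (f x * T f x) + T s x) μ ∧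
      ∫ x, (f x ^ 2 - 2 * (f x * T f x) + T s x) ∂μ
        = inner ℝ f f - 2 * inner ℝ f (T f) + ∫ x, T s x ∂μ := by
  have i1 : Integrable (fun x => f x ^ 2) μ := (Lp.memLp f).integrable_sq
  have i2 : Integrable (fun x => 2 * (f x * T f x)) μ := (integrable_L2_mul f (T f)).const_mul 2
  have i3 := (hT.integrable_map (h := s) (by
    filter_upwards [hs] with x hx; rw [hx]; positivity) (integrable_sq_of hs)).1
  refine ⟨(i1.sub i2).add i3, ?_⟩
  rw [integral_add (f := fun x => f x ^ 2 - 2 * (f x * T f x)) (i1.sub i2) i3,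
    integral_sub i1 i2, integral_const_mul, inner_L2_eq, inner_L2_eq]
  simp only [sq]

/-- The approximating forms are decreased by squaring, up to a factor. -/
lemma inner_sq_sub_le [SigmaFinite μ] (hT : IsSubMarkov T) {f s : Lp ℝ 2 μ} {M : ℝ} (hM0 : 0 ≤ M)
    (hM : ∀ᵐ x ∂μ, |f x| ≤ M) (hs : ∀ᵐ x ∂μ, s x = f x ^ 2) :
    inner ℝ (s - T s) s ≤ 4 * M ^ 2 * inner ℝ (f - T f) f := by
  have hfb : IsBdd f := ⟨M, hM⟩
  have hsb : IsBdd s := hfb.of_mul hfb (by filter_upwards [hs] with x hx; rw [hx, sq])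
  obtain ⟨r, hr'⟩ := exists_mul_L2 hsb s
  have hr : ∀ᵐ x ∂μ, r x = s x ^ 2 := by filter_upwards [hr'] with x hx; rw [hx, sq]
  have g1 := hT.integrable_carre_du_champ hs
  have g2 := hT.integrable_carre_du_champ hr
  have hle := integral_mono_ae g2.1 (g1.1.const_mul (4 * M ^ 2))
    (hT.carre_du_champ_sq_le hM0 hM hs hr)
  rw [integral_const_mul, g1.2, g2.2] at hle
  have ir := integrable_sq_of hr
  have is := integrable_sq_of hs
  have ks := hT.integrable_map (h := s) (by
    filter_upwards [hs] with x hx; rw [hx]; positivity) is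
  have kr := hT.integrable_map (h := r) (by
    filter_upwards [hr] with x hx; rw [hx]; positivity) ir
  have e : ∀ᵐ x ∂μ, ((4 * M ^ 2) • s - r : Lp ℝ 2 μ) x = 4 * M ^ 2 * s x - r x := by
    filter_upwards [Lp.coeFn_sub ((4 * M ^ 2) • s) r, Lp.coeFn_smul (4 * M ^ 2) s] with x h1 h2
    rw [h1, Pi.sub_apply, h2, Pi.smul_apply, smul_eq_mul]
  have eT : ∀ᵐ x ∂μ, T ((4 * M ^ 2) • s - r) x = 4 * M ^ 2 * T s x - T r x := by
    rw [map_sub, map_smul]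
    filter_upwards [Lp.coeFn_sub ((4 * M ^ 2) • T s) (T r), Lp.coeFn_smul (4 * M ^ 2) (T s)]
      with x h1 h2
    rw [h1, Pi.sub_apply, h2, Pi.smul_apply, smul_eq_mul]
  -- The integral of the carré du champ of `f` is `2 ⟨f - T f, f⟩` minus the mass lost by `f²`. The
  -- two loss terms compare in the right direction because `4 M² f² - f⁴ ≥ 0` also does not gain
  -- mass under `T`.
  have hd := hT.integrable_map (h := (4 * M ^ 2) • s - r) (by
    filter_upwards [e, hM, hs, hr] with x h1 h2 h3 h4
    rw [h1, h4, h3]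
    have : f x ^ 2 ≤ M ^ 2 := by
      rw [← sq_abs]; exact pow_le_pow_left₀ (abs_nonneg _) h2 2
    nlinarith [sq_nonneg (f x)]) (by
      refine ((is.const_mul (4 * M ^ 2)).sub ir).congr ?_
      filter_upwards [e] with x hx using hx.symm)
  have hd2 := hd.2
  rw [integral_congr_ae e, integral_congr_ae eT, integral_sub (is.const_mul _) ir,
    integral_sub (ks.1.const_mul _) kr.1, integral_const_mul, integral_const_mul,
    integral_sq_eq hs, integral_sq_eq hr] at hd2
  rw [inner_sub_left, inner_sub_left, hT.symm, hT.symm]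
  nlinarith

end IsSubMarkov

/-- The symmetric bilinear form `(f, g) ↦ ∫ φ f g + (T φ) f g - φ f T g - φ g T f`, which is
`∫ φ Γ(f, g)` for the carré du champ `Γ` of `T`. -/
def champForm {K : Type*} [MeasurableSpace K] {μ : Measure K} (T : Lp ℝ 2 μ →L[ℝ] Lp ℝ 2 μ)
    (φ f g : Lp ℝ 2 μ) : ℝ :=
  ∫ x, φ x * (f x * g x) ∂μ + ∫ x, T φ x * (f x * g x) ∂μ - ∫ x, φ x * (f x * T g x) ∂μ
    - ∫ x, φ x * (g x * T f x) ∂μ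

namespace IsSubMarkov

variable {K : Type*} [MeasurableSpace K] {μ : Measure K} {T : Lp ℝ 2 μ →L[ℝ] Lp ℝ 2 μ}

lemma champForm_symm (φ f g : Lp ℝ 2 μ) : champForm T φ f g = champForm T φ g f := by
  unfold champForm
  simp only [mul_comm (g _) (f _)]
  ring

/-- Writing the form through bounded operators yields its bilinearity, and the continuity needed to
pass from bounded functions to all of L². -/
lemma exists_champForm_eq_inner (hT : IsSubMarkov T) {φ : Lp ℝ 2 μ} (hφ : IsBdd φ) :
    ∃ M N : Lp ℝ 2 μ →L[ℝ] Lp ℝ 2 μ, ∀ f g, champForm T φ f g =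
      inner ℝ (M f) g + inner ℝ (N f) g - inner ℝ (M f) (T g) - inner ℝ (M g) (T f) := by
  obtain ⟨M, hM⟩ := exists_mulOp hφ
  obtain ⟨N, hN⟩ := exists_mulOp (hT.isBdd_map hφ)
  exact ⟨M, N, fun f g => by rw [hM, hN, hM, hM, champForm]⟩

lemma champForm_add_left (hT : IsSubMarkov T) {φ : Lp ℝ 2 μ} (hφ : IsBdd φ) (f f' g : Lp ℝ 2 μ) :
    champForm T φ (f + f') g = champForm T φ f g + champForm T φ f' g := by
  obtain ⟨M, N, h⟩ := hT.exists_champForm_eq_inner hφ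
  simp only [h, map_add, inner_add_left, inner_add_right]
  ring

lemma champForm_smul_left (hT : IsSubMarkov T) {φ : Lp ℝ 2 μ} (hφ : IsBdd φ) (c : ℝ)
    (f g : Lp ℝ 2 μ) : champForm T φ (c • f) g = c * champForm T φ f g := by
  obtain ⟨M, N, h⟩ := hT.exists_champForm_eq_inner hφ
  simp only [h, map_smul, inner_smul_left, inner_smul_right]
  simp
  ring

lemma champForm_weight_add (hT : IsSubMarkov T) {φ ψ : Lp ℝ 2 μ} (hφ : IsBdd φ) (hψ : IsBdd ψ)
    (f g : Lp ℝ 2 μ) :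
    champForm T (φ + ψ) f g = champForm T φ f g + champForm T ψ f g := by
  have aux : ∀ {a b : Lp ℝ 2 μ}, IsBdd a → IsBdd b → ∀ u v : Lp ℝ 2 μ,
      ∫ x, (a + b : Lp ℝ 2 μ) x * (u x * v x) ∂μ
        = ∫ x, a x * (u x * v x) ∂μ + ∫ x, b x * (u x * v x) ∂μ := by
    intro a b ha hb u v
    rw [← integral_add (integrable_bdd_mul ha (integrable_L2_mul _ _))
      (integrable_bdd_mul hb (integrable_L2_mul _ _))]
    refine integral_congr_ae ?_
    filter_upwards [Lp.coeFn_add a b] with x hx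
    rw [hx, Pi.add_apply, add_mul]
  unfold champForm
  rw [map_add, aux hφ hψ, aux hφ hψ, aux hφ hψ, aux (hT.isBdd_map hφ) (hT.isBdd_map hψ)]
  ring

lemma champForm_weight_smul (c : ℝ) (φ f g : Lp ℝ 2 μ) :
    champForm T (c • φ) f g = c * champForm T φ f g := by
  have aux : ∀ a u v : Lp ℝ 2 μ,
      ∫ x, (c • a : Lp ℝ 2 μ) x * (u x * v x) ∂μ = c * ∫ x, a x * (u x * v x) ∂μ := by
    intro a u v
    rw [← integral_const_mul]
    refine integral_congr_ae ?_
    filter_upwards [Lp.coeFn_smul c a] with x hx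
    rw [hx, Pi.smul_apply, smul_eq_mul, mul_assoc]
  unfold champForm
  rw [map_smul, aux, aux, aux, aux]
  ring

/-- A weight that is at least `-δ` gives a form that is at least `-2 δ` times the approximating
form. -/
lemma le_champForm [SigmaFinite μ] (hT : IsSubMarkov T) {φ : Lp ℝ 2 μ} (hφ : IsBdd φ) {δ : ℝ}
    (hδ : 0 ≤ δ) (h : ∀ᵐ x ∂μ, -δ ≤ φ x) (f : Lp ℝ 2 μ) :
    -(2 * δ * inner ℝ (f - T f) f) ≤ champForm T φ f f := by
  refine bdd_induction (P := fun f => -(2 * δ * inner ℝ (f - T f) f) ≤ champForm T φ f f)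
    ?_ ?_ f
  · obtain ⟨M, N, hMN⟩ := hT.exists_champForm_eq_inner hφ
    simp only [hMN]
    exact isClosed_le (by fun_prop) (by fun_prop)
  · intro f hf
    obtain ⟨s, hs'⟩ := exists_mul_L2 hf f
    have hs : ∀ᵐ x ∂μ, s x = f x ^ 2 := by filter_upwards [hs'] with x hx; rw [hx, sq]
    have hΓ := hT.integrable_carre_du_champ hs
    have hcf : champForm T φ f f = ∫ x, φ x * (f x ^ 2 - 2 * (f x * T f x) + T s x) ∂μ := by
      -- For bounded `f` the square lies in L², so symmetry moves `T` from the weight to `f²` and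
      -- exposes the pointwise carré du champ.
      have e : ∫ x, T φ x * (f x * f x) ∂μ = ∫ x, φ x * T s x ∂μ := by
        rw [← inner_L2_eq, ← hT.symm, inner_L2_eq]
        refine integral_congr_ae ?_
        filter_upwards [hs'] with x hx
        rw [hx]
      unfold champForm
      have i1 := integrable_bdd_mul hφ (integrable_L2_mul f f)
      have i2 := integrable_L2_mul φ (T s)
      have i3 := (integrable_bdd_mul hφ (integrable_L2_mul f (T f))).const_mul 2
      have e2 : ∀ x, φ x * (f x ^ 2 - 2 * (f x * T f x) + T s x)
          = φ x * (f x * f x) + φ x * T s x - 2 * (φ x * (f x * T f x)) := fun x => by ring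
      simp only [e2]
      rw [e, integral_sub (f := fun x => φ x * (f x * f x) + φ x * T s x) (i1.add i2) i3,
        integral_add i1 i2, integral_const_mul]
      ring
    have h1 : -(δ * ∫ x, (f x ^ 2 - 2 * (f x * T f x) + T s x) ∂μ) ≤ champForm T φ f f := by
      rw [hcf, ← integral_const_mul, ← integral_neg]
      refine integral_mono_ae (hΓ.1.const_mul δ).neg (integrable_bdd_mul hφ hΓ.1) ?_
      filter_upwards [h, hT.carre_du_champ_nonneg hs] with x h1 h2
      nlinarith
    -- Since `∫ T (f²) ≤ ∫ f² = ⟨f, f⟩`, the carré du champ integrates to at most `2 ⟨f - T f, f⟩`;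
    -- this is the factor 2.
    have ks := hT.integrable_map (h := s) (by
      filter_upwards [hs] with x hx; rw [hx]; positivity) (integrable_sq_of hs)
    have h2 := ks.2
    rw [integral_sq_eq hs] at h2
    rw [hΓ.2] at h1
    rw [inner_sub_left, hT.symm]
    nlinarith

end IsSubMarkov

end

/-! ### Resolvents, approximating forms and the algebra of bounded functions in the domain -/

noncomputable section

namespace RegularDirichletForm

section FormSpace

variable {K : Type*} [TopologicalSpace K] [MeasurableSpace K] {μ : Measure K}

/-- The domain `ℱ`, as a Hilbert space with inner product `ℰ(f, g) + (n + 1) ∫ f g dμ`. -/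
def FormSpace (E : RegularDirichletForm μ) (_n : ℕ) : Type _ := E.domain

variable (E : RegularDirichletForm μ) (n : ℕ)

instance : AddCommGroup (E.FormSpace n) := inferInstanceAs (AddCommGroup E.domain)

instance : Module ℝ (E.FormSpace n) := inferInstanceAs (Module ℝ E.domain)

/-- The identity map from `FormSpace E n` to the domain. -/
def toDomain : E.FormSpace n →ₗ[ℝ] E.domain := LinearMap.id

/-- The identity map from the domain to `FormSpace E n`. -/
def ofDomain : E.domain →ₗ[ℝ] E.FormSpace n := LinearMap.id

lemma toDomain_ofDomain (f : E.domain) : E.toDomain n (E.ofDomain n f) = f := rfl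

/-- The inner product on `FormSpace E n`. -/
@[reducible] def formCore : InnerProductSpace.Core ℝ (E.FormSpace n) where
  inner f g := E.form (E.toDomain n f) (E.toDomain n g)
    + (n + 1) * inner ℝ (E.toDomain n f : Lp ℝ 2 μ) (E.toDomain n g : Lp ℝ 2 μ)
  conj_inner_symm f g := by
    simp only [conj_trivial]
    rw [E.form_comm, real_inner_comm]
  re_inner_nonneg f := by
    simp only [RCLike.re_to_real]
    have := E.form_nonneg (E.toDomain n f)
    have := real_inner_self_nonneg (x := (E.toDomain n f : Lp ℝ 2 μ))
    positivity
  add_left f g h := by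
    simp only [map_add, LinearMap.add_apply, Submodule.coe_add, inner_add_left]
    ring
  smul_left f g r := by
    simp only [map_smul, LinearMap.smul_apply, Submodule.coe_smul, inner_smul_left, smul_eq_mul]
    simp
    ring
  definite f hf := by
    have h1 := E.form_nonneg (E.toDomain n f)
    have h2 := real_inner_self_nonneg (x := (E.toDomain n f : Lp ℝ 2 μ))
    have h3 : inner ℝ (E.toDomain n f : Lp ℝ 2 μ) (E.toDomain n f : Lp ℝ 2 μ) = (0 : ℝ) := by
      have : (0 : ℝ) ≤ n := n.cast_nonneg
      nlinarith
    have h4 : (E.toDomain n f : Lp ℝ 2 μ) = 0 := inner_self_eq_zero.1 h3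
    exact Subtype.ext h4

instance : NormedAddCommGroup (E.FormSpace n) :=
  @InnerProductSpace.Core.toNormedAddCommGroup ℝ _ _ _ _ (E.formCore n)

instance : InnerProductSpace ℝ (E.FormSpace n) :=
  InnerProductSpace.ofCore (E.formCore n).toCore

lemma inner_formSpace (f g : E.FormSpace n) :
    inner ℝ f g = E.form (E.toDomain n f) (E.toDomain n g)
      + (n + 1) * inner ℝ (E.toDomain n f : Lp ℝ 2 μ) (E.toDomain n g : Lp ℝ 2 μ) := rfl

lemma norm_sq_formSpace (f : E.FormSpace n) :
    ‖f‖ ^ 2 = E.form (E.toDomain n f) (E.toDomain n f)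
      + (n + 1) * ‖(E.toDomain n f : Lp ℝ 2 μ)‖ ^ 2 := by
  rw [← real_inner_self_eq_norm_sq, inner_formSpace, real_inner_self_eq_norm_sq]

lemma formOne_self (f : E.domain) :
    formOne E.form f f = E.form f f + ‖(f : Lp ℝ 2 μ)‖ ^ 2 := by
  rw [formOne, real_inner_self_eq_norm_sq]

lemma formOne_le_norm_sq (f : E.FormSpace n) :
    formOne E.form (E.toDomain n f) (E.toDomain n f) ≤ ‖f‖ ^ 2 := by
  rw [norm_sq_formSpace, formOne_self]
  have : (0 : ℝ) ≤ n := n.cast_nonneg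
  nlinarith [sq_nonneg ‖(E.toDomain n f : Lp ℝ 2 μ)‖]

lemma norm_sq_le_formOne (f : E.FormSpace n) :
    ‖f‖ ^ 2 ≤ (n + 1) * formOne E.form (E.toDomain n f) (E.toDomain n f) := by
  rw [norm_sq_formSpace, formOne_self]
  have : (0 : ℝ) ≤ n := n.cast_nonneg
  nlinarith [E.form_nonneg (E.toDomain n f)]

lemma norm_toDomain_le (f : E.FormSpace n) : ‖(E.toDomain n f : Lp ℝ 2 μ)‖ ≤ ‖f‖ := by
  refine le_of_sq_le_sq ?_ (norm_nonneg _)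
  have := E.formOne_le_norm_sq n f
  rw [formOne_self] at this
  linarith [E.form_nonneg (E.toDomain n f)]

instance : CompleteSpace (E.FormSpace n) := by
  refine Metric.complete_of_cauchySeq_tendsto fun u hu => ?_
  obtain ⟨f, hf⟩ := E.closed (fun i => E.toDomain n (u i)) (by
    intro ε hε
    obtain ⟨N, hN⟩ := Metric.cauchySeq_iff.1 hu (√ε) (Real.sqrt_pos.2 hε)
    refine ⟨N, fun i hi j hj => ?_⟩
    have h1 := hN i hi j hj
    rw [dist_eq_norm] at h1
    rw [← map_sub]
    refine (E.formOne_le_norm_sq n _).trans_lt ?_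
    rw [← Real.sq_sqrt hε.le]
    exact pow_lt_pow_left₀ h1 (norm_nonneg _) two_ne_zero)
  refine ⟨E.ofDomain n f, tendsto_iff_norm_sub_tendsto_zero.2 ?_⟩
  have h1 : Tendsto (fun i => ‖u i - E.ofDomain n f‖ ^ 2) atTop (𝓝 0) := by
    refine squeeze_zero (fun i => sq_nonneg _) (fun i => E.norm_sq_le_formOne n _) ?_
    simpa [map_sub, toDomain_ofDomain] using hf.const_mul ((n : ℝ) + 1)
  have h2 := h1.sqrt
  simpa [Real.sqrt_sq (norm_nonneg _)] using h2

/-- The inclusion of the domain into `L²`. -/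
def incl : E.FormSpace n →L[ℝ] Lp ℝ 2 μ :=
  LinearMap.mkContinuous (E.domain.subtype ∘ₗ E.toDomain n) 1 (fun f => by
    rw [one_mul]; exact E.norm_toDomain_le n f)

/-- `(n + 1)` times the resolvent at `n + 1`, as a map to the domain. -/
def resolvent : Lp ℝ 2 μ →ₗ[ℝ] E.domain :=
  E.toDomain n ∘ₗ (((n : ℝ) + 1) • (ContinuousLinearMap.adjoint (E.incl n))).toLinearMap

/-- `(n + 1)` times the resolvent at `n + 1`, as an operator on `L²`. -/
def resolventOp : Lp ℝ 2 μ →L[ℝ] Lp ℝ 2 μ :=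
  E.incl n ∘L (((n : ℝ) + 1) • (ContinuousLinearMap.adjoint (E.incl n)))

lemma coe_resolvent (h : Lp ℝ 2 μ) : (E.resolvent n h : Lp ℝ 2 μ) = E.resolventOp n h := rfl

/-- The adjoint of the inclusion satisfies `ℰ(G h, v) + (n+1) ⟨G h, v⟩ = ⟨h, v⟩`. The right side
here is the approximating form at level `n`. -/
lemma form_resolvent (h : Lp ℝ 2 μ) (v : E.domain) :
    E.form (E.resolvent n h) v = (n + 1) * inner ℝ (h - E.resolventOp n h) (v : Lp ℝ 2 μ) := by
  have h1 : inner ℝ ((((n : ℝ) + 1) • (ContinuousLinearMap.adjoint (E.incl n))) h)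
      (E.ofDomain n v) = (n + 1) * inner ℝ h (v : Lp ℝ 2 μ) := by
    rw [_root_.smul_apply, real_inner_smul_left,
      ContinuousLinearMap.adjoint_inner_left]
    rfl
  rw [inner_formSpace] at h1
  have h2 : E.form (E.resolvent n h) v
      + (n + 1) * inner ℝ (E.resolventOp n h) (v : Lp ℝ 2 μ)
      = (n + 1) * inner ℝ h (v : Lp ℝ 2 μ) := h1
  rw [inner_sub_left]
  linarith

/-- The resolvent of `h` minimizes `ℰ(v, v) + (n+1) ‖v - h‖²` over the domain. If `h` takes values
in `[0, 1]`, the unit contraction of the minimizer does no worse, so uniqueness of the minimizer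
makes the two equal. -/
lemma isSubMarkov_resolventOp : IsSubMarkov (E.resolventOp n) where
  symm f g := by
    have h1 := E.form_resolvent n f (E.resolvent n g)
    have h2 := E.form_resolvent n g (E.resolvent n f)
    rw [E.form_comm, h2, coe_resolvent, coe_resolvent, inner_sub_left, inner_sub_left,
      real_inner_comm (E.resolventOp n f) (E.resolventOp n g)] at h1
    have h3 : ((n : ℝ) + 1) ≠ 0 := by positivity
    have h4 := mul_left_cancel₀ h3 h1
    rw [real_inner_comm]
    linarith
  unit h hh := by
    set u := E.resolvent n h with hu
    obtain ⟨w, hw, hww⟩ := E.markov u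
    -- Completing the square: the cross terms cancel by the variational equation for `u`.
    have hmin : E.form (w - u) (w - u) + (n + 1) * ‖((w - u : E.domain) : Lp ℝ 2 μ)‖ ^ 2
        = (E.form w w + (n + 1) * ‖(w : Lp ℝ 2 μ) - h‖ ^ 2)
          - (E.form u u + (n + 1) * ‖(u : Lp ℝ 2 μ) - h‖ ^ 2) := by
      have h1 := E.form_resolvent n h u
      have h2 := E.form_resolvent n h w
      rw [← coe_resolvent, ← hu] at h1 h2
      simp only [← real_inner_self_eq_norm_sq, Submodule.coe_sub, map_sub, LinearMap.sub_apply,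
        inner_sub_left, inner_sub_right] at h1 h2 ⊢
      rw [E.form_comm w u]
      rw [real_inner_comm (u : Lp ℝ 2 μ) (w : Lp ℝ 2 μ), real_inner_comm h (w : Lp ℝ 2 μ),
        real_inner_comm h (u : Lp ℝ 2 μ)] at *
      linarith
    have hnorm : ‖(w : Lp ℝ 2 μ) - h‖ ≤ ‖(u : Lp ℝ 2 μ) - h‖ := by
      refine Lp.norm_le_norm_of_ae_le ?_
      filter_upwards [hw, hh, Lp.coeFn_sub (w : Lp ℝ 2 μ) h, Lp.coeFn_sub (u : Lp ℝ 2 μ) h]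
        with x h1 h2 h3 h4
      rw [h3, h4, Pi.sub_apply, Pi.sub_apply, h1, Real.norm_eq_abs, Real.norm_eq_abs]
      set a := (u : Lp ℝ 2 μ) x
      have ha := neg_abs_le (a - h x)
      have hb := le_abs_self (a - h x)
      rw [abs_le]
      rcases le_total 0 a with h5 | h5 <;> rcases le_total a 1 with h6 | h6 <;>
        simp [h5, h6] <;> constructor <;> linarith [h2.1, h2.2]
    have hsq : ‖(w : Lp ℝ 2 μ) - h‖ ^ 2 ≤ ‖(u : Lp ℝ 2 μ) - h‖ ^ 2 :=
      pow_le_pow_left₀ (norm_nonneg _) hnorm 2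
    have hn : (0 : ℝ) < n + 1 := by positivity
    have hz : ‖((w - u : E.domain) : Lp ℝ 2 μ)‖ ^ 2 ≤ 0 := by
      have := E.form_nonneg (w - u)
      have := mul_le_mul_of_nonneg_left hsq hn.le
      by_contra hc
      push Not at hc
      nlinarith [mul_pos hn hc]
    have hwu : (w : Lp ℝ 2 μ) = E.resolventOp n h := by
      have h1 : ‖((w - u : E.domain) : Lp ℝ 2 μ)‖ = 0 := by
        nlinarith [norm_nonneg ((w - u : E.domain) : Lp ℝ 2 μ)]
      rw [norm_eq_zero, Submodule.coe_sub, sub_eq_zero] at h1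
      exact h1
    rw [← hwu]
    filter_upwards [hw] with x hx
    rw [hx]
    exact ⟨le_min (le_max_left _ _) zero_le_one, min_le_right _ _⟩

/-- Functions that are bounded in `ℱ` and converge in `L²` converge weakly in `ℱ`. -/
lemma exists_weak_limit (u : ℕ → E.domain) {C : ℝ} (hC : ∀ i, formOne E.form (u i) (u i) ≤ C)
    {w : Lp ℝ 2 μ} (hw : Tendsto (fun i => (u i : Lp ℝ 2 μ)) atTop (𝓝 w)) :
    ∃ f : E.domain, (f : Lp ℝ 2 μ) = w ∧
      ∀ v, Tendsto (fun i => E.form (u i) v) atTop (𝓝 (E.form f v)) := by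
  set U : ℕ → E.FormSpace 0 := fun i => E.ofDomain 0 (u i) with hU
  set G := ContinuousLinearMap.adjoint (E.incl 0) with hG
  have hUC : ∀ i, ‖U i‖ ≤ √C := by
    intro i
    apply Real.le_sqrt_of_sq_le
    refine (E.norm_sq_le_formOne 0 (U i)).trans ?_
    simpa [hU, toDomain_ofDomain] using hC i
  have hGw : ∀ h, Tendsto (fun i => inner ℝ (U i) (G h)) atTop (𝓝 (inner ℝ w h)) := by
    intro h
    have : ∀ i, inner ℝ (U i) (G h) = inner ℝ (u i : Lp ℝ 2 μ) h := by
      intro i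
      rw [hG, ContinuousLinearMap.adjoint_inner_right]
      rfl
    simp only [this]
    exact hw.inner tendsto_const_nhds
  -- The adjoint of an injective operator has dense range, and on that range pairing in `ℱ` is
  -- pairing in L², where convergence is known.
  have hdense : ∀ v : E.FormSpace 0, ∀ ε > 0, ∃ h, ‖v - G h‖ < ε := by
    have h1 : (LinearMap.range G.toLinearMap).topologicalClosure = ⊤ := by
      rw [Submodule.topologicalClosure_eq_top_iff, Submodule.eq_bot_iff]
      intro v hv
      have h2 : ∀ h, inner ℝ (G h) v = 0 := fun h =>
        (Submodule.mem_orthogonal _ _).1 hv _ ⟨h, rfl⟩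
      have h3 : E.incl 0 v = 0 := by
        have := h2 (E.incl 0 v)
        rw [hG, ContinuousLinearMap.adjoint_inner_left] at this
        exact inner_self_eq_zero.1 this
      exact Subtype.ext h3
    intro v ε hε
    have hv : v ∈ closure (LinearMap.range G.toLinearMap : Set (E.FormSpace 0)) := by
      rw [← Submodule.topologicalClosure_coe, h1]; trivial
    obtain ⟨_, ⟨h, rfl⟩, hh⟩ := Metric.mem_closure_iff.1 hv ε hε
    exact ⟨h, by rw [← dist_eq_norm]; exact hh⟩
  have hcau : ∀ v : E.FormSpace 0, CauchySeq fun i => inner ℝ (U i) v := by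
    intro v
    rw [Metric.cauchySeq_iff]
    intro ε hε
    obtain ⟨h, hh⟩ := hdense v (ε / (4 * (√C + 1))) (by positivity)
    obtain ⟨N, hN⟩ := Metric.cauchySeq_iff.1 (hGw h).cauchySeq (ε / 2) (by positivity)
    refine ⟨N, fun i hi j hj => ?_⟩
    have h1 := hN i hi j hj
    have h2 : ∀ i, |inner ℝ (U i) (v - G h)| ≤ ε / 4 := by
      intro i
      refine (abs_real_inner_le_norm _ _).trans ?_
      refine (mul_le_mul (hUC i) hh.le (norm_nonneg _) (Real.sqrt_nonneg _)).trans ?_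
      have hs := Real.sqrt_nonneg C
      rw [mul_div_assoc', div_le_div_iff₀ (by positivity) (by positivity)]
      nlinarith
    have e : ∀ i, inner ℝ (U i) v = inner ℝ (U i) (G h) + inner ℝ (U i) (v - G h) := by
      intro i; rw [← inner_add_right]; simp
    rw [Real.dist_eq] at h1 ⊢
    rw [e i, e j]
    have h3 := abs_lt.1 h1
    have h4 := abs_le.1 (h2 i)
    have h5 := abs_le.1 (h2 j)
    rw [abs_lt]
    constructor <;> linarith [h3.1, h3.2, h4.1, h4.2, h5.1, h5.2]
  choose ℓ hℓ using fun v => cauchySeq_tendsto_of_complete (hcau v)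
  have hlin : Tendsto (fun i v => innerSL ℝ (U i) v) atTop (𝓝 ℓ) := by
    rw [tendsto_pi_nhds]
    exact hℓ
  -- The pointwise limit of continuous functionals is continuous by Banach–Steinhaus, hence
  -- represented by a vector.
  set F := (InnerProductSpace.toDual ℝ (E.FormSpace 0)).symm
    (continuousLinearMapOfTendsto _ hlin) with hF
  have hFv : ∀ v, inner ℝ F v = ℓ v := by
    intro v
    rw [hF, InnerProductSpace.toDual_symm_apply]
    rfl
  have hFw : (E.toDomain 0 F : Lp ℝ 2 μ) = w := by
    refine ext_inner_right ℝ fun h => ?_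
    have h1 : inner ℝ F (G h) = inner ℝ w h := by
      rw [hFv]; exact tendsto_nhds_unique (hℓ _) (hGw h)
    rw [hG, ContinuousLinearMap.adjoint_inner_right] at h1
    exact h1
  refine ⟨E.toDomain 0 F, hFw, fun v => ?_⟩
  have h1 := hℓ (E.ofDomain 0 v)
  rw [← hFv] at h1
  simp only [inner_formSpace] at h1
  have h2 : Tendsto (fun i => ((0 : ℕ) + 1 : ℝ) * inner ℝ (u i : Lp ℝ 2 μ) (v : Lp ℝ 2 μ)) atTop
      (𝓝 (((0 : ℕ) + 1 : ℝ) * inner ℝ w (v : Lp ℝ 2 μ))) :=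
    (hw.inner tendsto_const_nhds).const_mul _
  have h3 := h1.sub h2
  simpa [hU, toDomain_ofDomain, hFw] using h3

/-- The approximating form at `w` equals `ℰ(R w, R w) + (n+1) ‖w - R w‖²` for the scaled resolvent
`R`. A uniform bound thus forces `R w → w` in L² with bounded energy, and weak limits put `w` into
the domain. -/
lemma exists_of_approx_le {w : Lp ℝ 2 μ} {C : ℝ}
    (hC : ∀ n : ℕ, (n + 1) * inner ℝ (w - E.resolventOp n w) w ≤ C) :
    ∃ f : E.domain, (f : Lp ℝ 2 μ) = w ∧
      ∀ v, Tendsto (fun n => E.form (E.resolvent n w) v) atTop (𝓝 (E.form f v)) := by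
  have key : ∀ n : ℕ, E.form (E.resolvent n w) (E.resolvent n w)
      + (n + 1) * ‖w - E.resolventOp n w‖ ^ 2 ≤ C := by
    intro n
    refine le_trans (le_of_eq ?_) (hC n)
    rw [form_resolvent, coe_resolvent, ← real_inner_self_eq_norm_sq, ← mul_add, ← inner_add_right]
    simp
  have hC0 : 0 ≤ C := le_trans (by
    have := E.form_nonneg (E.resolvent 0 w)
    positivity) (key 0)
  have hlim : Tendsto (fun n => (E.resolvent n w : Lp ℝ 2 μ)) atTop (𝓝 w) := by
    rw [tendsto_iff_norm_sub_tendsto_zero]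
    have h1 : Tendsto (fun n : ℕ => C * (1 / ((n : ℝ) + 1))) atTop (𝓝 0) := by
      simpa using tendsto_one_div_add_atTop_nhds_zero_nat.const_mul C
    have h2 : Tendsto (fun n => ‖(E.resolvent n w : Lp ℝ 2 μ) - w‖ ^ 2) atTop (𝓝 0) := by
      refine squeeze_zero (fun n => sq_nonneg _) (fun n => ?_) h1
      rw [coe_resolvent, norm_sub_rev, mul_one_div, le_div_iff₀ (by positivity)]
      have := key n
      have := E.form_nonneg (E.resolvent n w)
      linarith
    simpa [Real.sqrt_sq (norm_nonneg _)] using h2.sqrt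
  refine E.exists_weak_limit (fun n => E.resolvent n w) (C := C + (‖w‖ + √C) ^ 2) (fun n => ?_) hlim
  rw [formOne_self]
  have h1 := key n
  have h2 : ‖w - E.resolventOp n w‖ ≤ √C := by
    apply Real.le_sqrt_of_sq_le
    have := E.form_nonneg (E.resolvent n w)
    have h3 : (0 : ℝ) ≤ n := n.cast_nonneg
    nlinarith [sq_nonneg ‖w - E.resolventOp n w‖]
  have h3 : ‖(E.resolvent n w : Lp ℝ 2 μ)‖ ≤ ‖w‖ + √C := by
    rw [coe_resolvent]
    have := norm_sub_le w (w - E.resolventOp n w)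
    rw [sub_sub_cancel] at this
    linarith
  have h4 := pow_le_pow_left₀ (norm_nonneg _) h3 2
  have h5 : 0 ≤ (n + 1) * ‖w - E.resolventOp n w‖ ^ 2 := by positivity
  linarith

/-- With `R` the scaled resolvent of `f`, `ℰ(R, f) - ℰ(R, R)` is `(n+1) ‖f - R‖² ≥ 0`.
Cauchy–Schwarz then gives `ℰ(R, f)² ≤ ℰ(R, f) ℰ(f, f)`. -/
lemma form_resolvent_self_le (f : E.domain) :
    E.form (E.resolvent n (f : Lp ℝ 2 μ)) f ≤ E.form f f := by
  set R := E.resolvent n (f : Lp ℝ 2 μ) with hR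
  have h1 : E.form R R ≤ E.form R f := by
    rw [hR, form_resolvent, form_resolvent]
    refine mul_le_mul_of_nonneg_left ?_ (by positivity)
    rw [coe_resolvent, ← sub_nonneg, ← inner_sub_right]
    exact real_inner_self_nonneg
  have h2 := LinearMap.BilinForm.apply_mul_apply_le_of_forall_zero_le E.form E.form_nonneg R f
  rw [E.form_comm f R] at h2
  have h3 := E.form_nonneg R
  have h4 := E.form_nonneg f
  by_contra hc
  push Not at hc
  nlinarith

lemma approx_self_le (f : E.domain) :
    (n + 1) * inner ℝ ((f : Lp ℝ 2 μ) - E.resolventOp n f) (f : Lp ℝ 2 μ) ≤ E.form f f := by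
  rw [← form_resolvent]
  exact E.form_resolvent_self_le n f

lemma tendsto_form_resolvent (f v : E.domain) :
    Tendsto (fun n => E.form (E.resolvent n (f : Lp ℝ 2 μ)) v) atTop (𝓝 (E.form f v)) := by
  obtain ⟨g, hg, h⟩ := E.exists_of_approx_le (fun n => E.approx_self_le n f)
  have : g = f := Subtype.ext hg
  rw [← this] at h ⊢
  exact h v

/-- The approximating forms of `f²` are at most `4 M² ℰ(f, f)`, so the membership criterion
`exists_of_approx_le` applies. -/
lemma exists_sq [SigmaFinite μ] {f : E.domain} (hf : IsBdd (f : Lp ℝ 2 μ)) :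
    ∃ s : E.domain, ∀ᵐ x ∂μ, (s : Lp ℝ 2 μ) x = (f : Lp ℝ 2 μ) x ^ 2 := by
  obtain ⟨M, hM0, hM⟩ := hf.exists_pos
  obtain ⟨s, hs'⟩ := exists_mul_L2 hf (f : Lp ℝ 2 μ)
  have hs : ∀ᵐ x ∂μ, s x = (f : Lp ℝ 2 μ) x ^ 2 := by
    filter_upwards [hs'] with x hx; rw [hx, sq]
  obtain ⟨g, hg, -⟩ := E.exists_of_approx_le (w := s) (C := 4 * M ^ 2 * E.form f f) (fun n => by
    have h1 := (E.isSubMarkov_resolventOp n).inner_sq_sub_le hM0.le hM hs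
    have h2 := E.approx_self_le n f
    calc _ ≤ (n + 1) * (4 * M ^ 2 * inner ℝ ((f : Lp ℝ 2 μ) - E.resolventOp n f)
          (f : Lp ℝ 2 μ)) := mul_le_mul_of_nonneg_left h1 (by positivity)
      _ = 4 * M ^ 2 * ((n + 1) * inner ℝ ((f : Lp ℝ 2 μ) - E.resolventOp n f)
          (f : Lp ℝ 2 μ)) := by ring
      _ ≤ _ := mul_le_mul_of_nonneg_left h2 (by positivity))
  exact ⟨g, by rwa [hg]⟩

lemma exists_mul [SigmaFinite μ] {f g : E.domain} (hf : IsBdd (f : Lp ℝ 2 μ))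
    (hg : IsBdd (g : Lp ℝ 2 μ)) :
    ∃ u : E.domain, ∀ᵐ x ∂μ, (u : Lp ℝ 2 μ) x = (f : Lp ℝ 2 μ) x * (g : Lp ℝ 2 μ) x := by
  obtain ⟨a, ha⟩ := E.exists_sq hf
  obtain ⟨b, hb⟩ := E.exists_sq hg
  obtain ⟨c, hc⟩ := E.exists_sq (f := f + g) (by
    rw [Submodule.coe_add]; exact hf.add hg)
  refine ⟨(1 / 2 : ℝ) • (c - a - b), ?_⟩
  filter_upwards [ha, hb, hc, Lp.coeFn_smul (1 / 2 : ℝ) ((c - a - b : E.domain) : Lp ℝ 2 μ),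
    Lp.coeFn_sub ((c - a : E.domain) : Lp ℝ 2 μ) (b : Lp ℝ 2 μ),
    Lp.coeFn_sub (c : Lp ℝ 2 μ) (a : Lp ℝ 2 μ), Lp.coeFn_add (f : Lp ℝ 2 μ) (g : Lp ℝ 2 μ)]
    with x h1 h2 h3 h4 h5 h6 h7
  rw [Submodule.coe_smul, h4, Pi.smul_apply, Submodule.coe_sub, h5, Pi.sub_apply,
    Submodule.coe_sub, h6, Pi.sub_apply, h1, h2, h3, Submodule.coe_add, h7, Pi.add_apply,
    smul_eq_mul]
  ring

/-- The approximation of `2 ℰ(f φ, f) - ℰ(φ, f²)` by the carré du champ of the resolvent. -/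
lemma tendsto_champForm {f g s u : E.domain}
    (hs : ∀ᵐ x ∂μ, (s : Lp ℝ 2 μ) x = (f : Lp ℝ 2 μ) x ^ 2)
    (hu : ∀ᵐ x ∂μ, (u : Lp ℝ 2 μ) x = (f : Lp ℝ 2 μ) x * (g : Lp ℝ 2 μ) x) :
    Tendsto (fun n : ℕ => ((n : ℝ) + 1) * champForm (E.resolventOp n) (g : Lp ℝ 2 μ) f f) atTop
      (𝓝 (2 * E.form u f - E.form g s)) := by
  have h1 := ((E.tendsto_form_resolvent f u).const_mul 2).sub (E.tendsto_form_resolvent g s)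
  rw [E.form_comm f u] at h1
  refine h1.congr fun n => ?_
  have e1 : ∫ x, (g : Lp ℝ 2 μ) x * ((f : Lp ℝ 2 μ) x * (f : Lp ℝ 2 μ) x) ∂μ
      = inner ℝ (f : Lp ℝ 2 μ) (u : Lp ℝ 2 μ) := by
    rw [inner_L2_eq]
    refine integral_congr_ae ?_
    filter_upwards [hu] with x hx
    rw [hx]; ring
  -- The terms without resolvent add up to `2 ⟨f, u⟩ - ⟨g, s⟩`; both products are `∫ g f²`, which
  -- leaves the single such integral in `champForm`.
  have e1' : inner ℝ (g : Lp ℝ 2 μ) (s : Lp ℝ 2 μ) = inner ℝ (f : Lp ℝ 2 μ) (u : Lp ℝ 2 μ) := by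
    rw [inner_L2_eq, inner_L2_eq]
    refine integral_congr_ae ?_
    filter_upwards [hu, hs] with x hx hy
    rw [hx, hy]; ring
  have e2 : ∫ x, E.resolventOp n (g : Lp ℝ 2 μ) x * ((f : Lp ℝ 2 μ) x * (f : Lp ℝ 2 μ) x) ∂μ
      = inner ℝ (E.resolventOp n g) (s : Lp ℝ 2 μ) := by
    rw [inner_L2_eq]
    refine integral_congr_ae ?_
    filter_upwards [hs] with x hx
    rw [hx, sq]
  have e3 : ∫ x, (g : Lp ℝ 2 μ) x * ((f : Lp ℝ 2 μ) x * E.resolventOp n (f : Lp ℝ 2 μ) x) ∂μ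
      = inner ℝ (E.resolventOp n f) (u : Lp ℝ 2 μ) := by
    rw [inner_L2_eq]
    refine integral_congr_ae ?_
    filter_upwards [hu] with x hx
    rw [hx]; ring
  rw [champForm, e1, e2, e3, form_resolvent, form_resolvent, inner_sub_left, inner_sub_left, e1']
  ring

end FormSpace

end RegularDirichletForm

end

/-! ### Existence, uniqueness and bilinearity of energy measures -/

noncomputable section

namespace RegularDirichletForm

open scoped CompactlySupported

variable {K : Type*} [TopologicalSpace K] [MeasurableSpace K] {μ : Measure K}

section

variable [LocallyCompactSpace K] [T2Space K] [BorelSpace K] [SecondCountableTopology K]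
  [TopologicalSpace.PseudoMetrizableSpace K]

lemma exists_cc_eqOn_one {S : Set K} (hS : IsCompact S) :
    ∃ ψ : C_c(K, ℝ), (∀ x ∈ S, ψ x = 1) ∧ ∀ x, 0 ≤ ψ x ∧ ψ x ≤ 1 := by
  obtain ⟨f, hf1, hf2, hf3⟩ :=
    exists_continuousMap_one_of_isCompact_subset_isOpen hS isOpen_univ (Set.subset_univ S)
  exact ⟨⟨f, hasCompactSupport_def.mpr hf2⟩, hf1, fun x => hf3.2 x⟩

/-- The reference measure of a regular Dirichlet form is finite on compact sets. -/
lemma isFiniteMeasureOnCompacts (E : RegularDirichletForm μ) : IsFiniteMeasureOnCompacts μ := by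
  refine ⟨fun S hS => ?_⟩
  obtain ⟨ψ, hψ, -⟩ := exists_cc_eqOn_one hS
  obtain ⟨g, φ, hg, hφ⟩ := E.regular_continuous ψ (1 / 2) (by norm_num)
  have hm : MemLp φ 2 μ := (Lp.memLp (g : Lp ℝ 2 μ)).ae_eq hg
  refine lt_of_le_of_lt (measure_mono fun x hx => ?_)
    (hm.meas_ge_lt_top' (by simp) (by simp) (ε := (1 / 2 : NNReal)) (by simp))
  have h1 := hφ x
  rw [hψ x hx] at h1
  have h2 := abs_lt.1 h1
  have h3 : (1 / 2 : ℝ) ≤ ‖φ x‖ := by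
    rw [Real.norm_eq_abs]; exact le_trans (by linarith) (le_abs_self _)
  change ((1 / 2 : NNReal) : ENNReal) ≤ ‖φ x‖ₑ
  rw [enorm_eq_nnnorm, ENNReal.coe_le_coe, ← NNReal.coe_le_coe]
  simpa using h3

lemma memLp_cc (E : RegularDirichletForm μ) (ψ : C_c(K, ℝ)) : MemLp ψ 2 μ :=
  have := E.isFiniteMeasureOnCompacts
  ψ.continuous.memLp_of_hasCompactSupport ψ.hasCompactSupport

/-- A continuous function with compact support as an element of `L²`. -/
def ccLp (E : RegularDirichletForm μ) (ψ : C_c(K, ℝ)) : Lp ℝ 2 μ := (E.memLp_cc ψ).toLp ψ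

lemma coeFn_ccLp (E : RegularDirichletForm μ) (ψ : C_c(K, ℝ)) : E.ccLp ψ =ᵐ[μ] ψ :=
  (E.memLp_cc ψ).coeFn_toLp

lemma cc_abs_le (ψ : C_c(K, ℝ)) : ∃ C : ℝ, 0 ≤ C ∧ ∀ x, |ψ x| ≤ C := by
  obtain ⟨C, hC⟩ := ψ.hasCompactSupport.exists_bound_of_continuous ψ.continuous
  exact ⟨max C 0, le_max_right _ _, fun x => (hC x).trans (le_max_left _ _)⟩

lemma isBdd_ccLp (E : RegularDirichletForm μ) (ψ : C_c(K, ℝ)) : IsBdd (E.ccLp ψ) := by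
  obtain ⟨C, -, hC⟩ := cc_abs_le ψ
  refine ⟨C, ?_⟩
  filter_upwards [E.coeFn_ccLp ψ] with x hx
  rw [hx]; exact hC x

lemma ccLp_add (E : RegularDirichletForm μ) (ψ χ : C_c(K, ℝ)) :
    E.ccLp (ψ + χ) = E.ccLp ψ + E.ccLp χ := rfl

lemma ccLp_smul (E : RegularDirichletForm μ) (c : ℝ) (ψ : C_c(K, ℝ)) :
    E.ccLp (c • ψ) = c • E.ccLp ψ := rfl

variable [SigmaFinite μ] (E : RegularDirichletForm μ)

/-- The approximation at level `n` of the energy functional. -/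
def approxEnergy (n : ℕ) (ψ : C_c(K, ℝ)) (f g : E.domain) : ℝ :=
  ((n : ℝ) + 1) * champForm (E.resolventOp n) (E.ccLp ψ) f g

lemma approxEnergy_add_left (n : ℕ) (ψ : C_c(K, ℝ)) (f f' g : E.domain) :
    E.approxEnergy n ψ (f + f') g = E.approxEnergy n ψ f g + E.approxEnergy n ψ f' g := by
  rw [approxEnergy, Submodule.coe_add,
    (E.isSubMarkov_resolventOp n).champForm_add_left (E.isBdd_ccLp ψ), mul_add]
  rfl

lemma approxEnergy_smul_left (n : ℕ) (ψ : C_c(K, ℝ)) (c : ℝ) (f g : E.domain) :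
    E.approxEnergy n ψ (c • f) g = c * E.approxEnergy n ψ f g := by
  rw [approxEnergy, Submodule.coe_smul,
    (E.isSubMarkov_resolventOp n).champForm_smul_left (E.isBdd_ccLp ψ), mul_left_comm]
  rfl

lemma approxEnergy_symm (n : ℕ) (ψ : C_c(K, ℝ)) (f g : E.domain) :
    E.approxEnergy n ψ f g = E.approxEnergy n ψ g f := by
  rw [approxEnergy, IsSubMarkov.champForm_symm]
  rfl

lemma approxEnergy_weight_add (n : ℕ) (ψ χ : C_c(K, ℝ)) (f g : E.domain) :
    E.approxEnergy n (ψ + χ) f g = E.approxEnergy n ψ f g + E.approxEnergy n χ f g := by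
  rw [approxEnergy, ccLp_add, (E.isSubMarkov_resolventOp n).champForm_weight_add
    (E.isBdd_ccLp ψ) (E.isBdd_ccLp χ), mul_add]
  rfl

lemma approxEnergy_weight_smul (n : ℕ) (c : ℝ) (ψ : C_c(K, ℝ)) (f g : E.domain) :
    E.approxEnergy n (c • ψ) f g = c * E.approxEnergy n ψ f g := by
  rw [approxEnergy, ccLp_smul, IsSubMarkov.champForm_weight_smul, mul_left_comm]
  rfl

lemma le_approxEnergy (n : ℕ) {ψ : C_c(K, ℝ)} {δ : ℝ} (hδ : 0 ≤ δ) (h : ∀ x, -δ ≤ ψ x)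
    (f : E.domain) : -(2 * δ * E.form f f) ≤ E.approxEnergy n ψ f f := by
  have h1 := (E.isSubMarkov_resolventOp n).le_champForm (E.isBdd_ccLp ψ) hδ
    (by filter_upwards [E.coeFn_ccLp ψ] with x hx; rw [hx]; exact h x) (f : Lp ℝ 2 μ)
  have h2 := mul_le_mul_of_nonneg_left (E.approx_self_le n f) hδ
  have h3 := mul_le_mul_of_nonneg_left h1 (by positivity : (0 : ℝ) ≤ n + 1)
  unfold approxEnergy
  nlinarith

lemma exists_abs_approxEnergy_le (ψ : C_c(K, ℝ)) (f g : E.domain) :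
    ∃ C, ∀ n, |E.approxEnergy n ψ f g| ≤ C := by
  obtain ⟨C, hC0, hC⟩ := cc_abs_le ψ
  have key : ∀ f : E.domain, ∀ n, |E.approxEnergy n ψ f f| ≤ 2 * C * E.form f f := by
    intro f n
    have h1 := E.le_approxEnergy n hC0 (fun x => (abs_le.1 (hC x)).1) f
    have h2 := E.le_approxEnergy n (ψ := (-1 : ℝ) • ψ) hC0 (fun x => by
      simpa using (abs_le.1 (hC x)).2) f
    rw [approxEnergy_weight_smul] at h2
    rw [abs_le]; constructor <;> linarith
  refine ⟨2 * C * E.form (f + g) (f + g) + 2 * C * E.form f f + 2 * C * E.form g g, fun n => ?_⟩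
  have e : E.approxEnergy n ψ (f + g) (f + g) = E.approxEnergy n ψ f f
      + 2 * E.approxEnergy n ψ f g + E.approxEnergy n ψ g g := by
    rw [approxEnergy_add_left, E.approxEnergy_symm n ψ f (f + g),
      E.approxEnergy_symm n ψ g (f + g), approxEnergy_add_left, approxEnergy_add_left,
      E.approxEnergy_symm n ψ g f]
    ring
  have h1 := abs_le.1 (key (f + g) n)
  have h2 := abs_le.1 (key f n)
  have h3 := abs_le.1 (key g n)
  have h4 := (abs_nonneg _).trans (key (f + g) n)
  have h5 := (abs_nonneg _).trans (key f n)
  have h6 := (abs_nonneg _).trans (key g n)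
  rw [abs_le]; constructor <;> linarith [h1.1, h1.2, h2.1, h2.2, h3.1, h3.2]

/-- The limit of the approximations along an ultrafilter. -/
def energyLim (ψ : C_c(K, ℝ)) (f g : E.domain) : ℝ :=
  limUnder (hyperfilter ℕ : Filter ℕ) fun n => E.approxEnergy n ψ f g

/-- Bounded real sequences converge along an ultrafilter. This gives a limit even when `ψ` is not in
`ℱ` or `f` is unbounded, and it preserves linear relations and inequalities. -/
lemma tendsto_energyLim (ψ : C_c(K, ℝ)) (f g : E.domain) :
    Tendsto (fun n => E.approxEnergy n ψ f g) (hyperfilter ℕ : Filter ℕ)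
      (𝓝 (E.energyLim ψ f g)) := by
  apply tendsto_nhds_limUnder
  obtain ⟨C, hC⟩ := E.exists_abs_approxEnergy_le ψ f g
  obtain ⟨a, -, ha⟩ := (isCompact_Icc (a := -C) (b := C)).ultrafilter_le_nhds'
    ((hyperfilter ℕ).map fun n => E.approxEnergy n ψ f g)
    (Ultrafilter.mem_map.2 (Eventually.of_forall fun n => abs_le.1 (hC n)))
  exact ⟨a, ha⟩

/-- The energy functional with weight `ψ`, as a bilinear form on `ℱ`. -/
def energyForm (ψ : C_c(K, ℝ)) : LinearMap.BilinForm ℝ E.domain :=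
  LinearMap.mk₂ ℝ (E.energyLim ψ)
    (fun f f' g => tendsto_nhds_unique (E.tendsto_energyLim ψ (f + f') g) (by
      simpa only [approxEnergy_add_left] using
        (E.tendsto_energyLim ψ f g).add (E.tendsto_energyLim ψ f' g)))
    (fun c f g => tendsto_nhds_unique (E.tendsto_energyLim ψ (c • f) g) (by
      simpa only [approxEnergy_smul_left, smul_eq_mul] using (E.tendsto_energyLim ψ f g).const_mul c))
    (fun f g g' => tendsto_nhds_unique (E.tendsto_energyLim ψ f (g + g')) (by
      simpa only [E.approxEnergy_symm _ ψ f, approxEnergy_add_left] using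
        (E.tendsto_energyLim ψ f g).add (E.tendsto_energyLim ψ f g')))
    (fun c f g => tendsto_nhds_unique (E.tendsto_energyLim ψ f (c • g)) (by
      simpa only [E.approxEnergy_symm _ ψ f, approxEnergy_smul_left, smul_eq_mul] using
        (E.tendsto_energyLim ψ f g).const_mul c))

lemma tendsto_energyForm (ψ : C_c(K, ℝ)) (f g : E.domain) :
    Tendsto (fun n => E.approxEnergy n ψ f g) (hyperfilter ℕ : Filter ℕ)
      (𝓝 (E.energyForm ψ f g)) := E.tendsto_energyLim ψ f g

lemma energyForm_symm (ψ : C_c(K, ℝ)) (f g : E.domain) :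
    E.energyForm ψ f g = E.energyForm ψ g f :=
  tendsto_nhds_unique (E.tendsto_energyForm ψ f g) (by
    simpa only [E.approxEnergy_symm _ ψ f] using E.tendsto_energyForm ψ g f)

lemma energyForm_weight_add (ψ χ : C_c(K, ℝ)) (f g : E.domain) :
    E.energyForm (ψ + χ) f g = E.energyForm ψ f g + E.energyForm χ f g :=
  tendsto_nhds_unique (E.tendsto_energyForm _ f g) (by
    simpa only [approxEnergy_weight_add] using
      (E.tendsto_energyForm ψ f g).add (E.tendsto_energyForm χ f g))

lemma energyForm_weight_smul (c : ℝ) (ψ : C_c(K, ℝ)) (f g : E.domain) :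
    E.energyForm (c • ψ) f g = c * E.energyForm ψ f g :=
  tendsto_nhds_unique (E.tendsto_energyForm _ f g) (by
    simpa only [approxEnergy_weight_smul] using (E.tendsto_energyForm ψ f g).const_mul c)

lemma le_energyForm {ψ : C_c(K, ℝ)} {δ : ℝ} (hδ : 0 ≤ δ) (h : ∀ x, -δ ≤ ψ x) (f : E.domain) :
    -(2 * δ * E.form f f) ≤ E.energyForm ψ f f :=
  ge_of_tendsto (E.tendsto_energyForm ψ f f)
    (Eventually.of_forall fun n => E.le_approxEnergy n hδ h f)

lemma energyForm_le {ψ : C_c(K, ℝ)} {δ : ℝ} (hδ : 0 ≤ δ) (h : ∀ x, ψ x ≤ δ) (f : E.domain) :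
    E.energyForm ψ f f ≤ 2 * δ * E.form f f := by
  have := E.le_energyForm (ψ := (-1 : ℝ) • ψ) hδ (fun x => by simpa using h x) f
  rw [energyForm_weight_smul] at this
  linarith

/-- For bounded `f`, the energy functional is given by the form. -/
lemma energyForm_eq {f g s u : E.domain} {φ : C_c(K, ℝ)} (hg : ∀ᵐ x ∂μ, (g : Lp ℝ 2 μ) x = φ x)
    (hs : ∀ᵐ x ∂μ, (s : Lp ℝ 2 μ) x = (f : Lp ℝ 2 μ) x ^ 2)
    (hu : ∀ᵐ x ∂μ, (u : Lp ℝ 2 μ) x = (f : Lp ℝ 2 μ) x * φ x) :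
    E.energyForm φ f f = 2 * E.form u f - E.form g s := by
  have hg' : E.ccLp φ = (g : Lp ℝ 2 μ) := by
    apply Lp.ext
    filter_upwards [hg, E.coeFn_ccLp φ] with x h1 h2
    rw [h1, h2]
  have hu' : ∀ᵐ x ∂μ, (u : Lp ℝ 2 μ) x = (f : Lp ℝ 2 μ) x * (g : Lp ℝ 2 μ) x := by
    filter_upwards [hg, hu] with x h1 h2
    rw [h1, h2]
  have h1 := E.tendsto_champForm hs hu'
  have h2 : Tendsto (fun n => E.approxEnergy n φ f f) atTop
      (𝓝 (2 * E.form u f - E.form g s)) := by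
    simpa only [approxEnergy, hg'] using h1
  exact tendsto_nhds_unique (E.tendsto_energyForm φ f f)
    (h2.mono_left (hyperfilter_le_cofinite.trans Nat.cofinite_eq_atTop.le))

/-- The positive functional on `C_c` that represents the energy measure of `f`. -/
def energyFunctional (f : E.domain) : C_c(K, ℝ) →ₚ[ℝ] ℝ :=
  PositiveLinearMap.mk₀
    { toFun := fun ψ => E.energyForm ψ f f
      map_add' := fun ψ χ => E.energyForm_weight_add ψ χ f f
      map_smul' := fun c ψ => E.energyForm_weight_smul c ψ f f }
    (fun ψ hψ => by
      have := E.le_energyForm (ψ := ψ) le_rfl (fun x => by simpa using hψ x) f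
      simpa using this)

/-- The energy measure of `f`, constructed from the energy functional. -/
def champMeasure (f : E.domain) : Measure K := RealRMK.rieszMeasure (E.energyFunctional f)

lemma integral_champMeasure (f : E.domain) (ψ : C_c(K, ℝ)) :
    ∫ x, ψ x ∂(E.champMeasure f) = E.energyForm ψ f f :=
  RealRMK.integral_rieszMeasure (E.energyFunctional f) ψ

/-- By inner regularity it suffices to bound compact sets, each dominated by some `ψ ∈ C_c` with `0
≤ ψ ≤ 1`. -/
lemma champMeasure_univ_le (f : E.domain) :
    E.champMeasure f Set.univ ≤ ENNReal.ofReal (2 * E.form f f) := by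
  have : (E.champMeasure f).Regular := RealRMK.regular_rieszMeasure _
  rw [isOpen_univ.measure_eq_iSup_isCompact]
  refine iSup₂_le fun S _ => iSup_le fun hS => ?_
  obtain ⟨ψ, hψ1, hψ⟩ := exists_cc_eqOn_one hS
  refine (RealRMK.rieszMeasure_le_of_eq_one (E.energyFunctional f) (fun x => (hψ x).1) hS
    hψ1).trans (ENNReal.ofReal_le_ofReal ?_)
  have := E.energyForm_le zero_le_one (fun x => (hψ x).2) f
  rwa [mul_one] at this

instance (f : E.domain) : IsFiniteMeasure (E.champMeasure f) :=
  ⟨(E.champMeasure_univ_le f).trans_lt ENNReal.ofReal_lt_top⟩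

lemma champMeasure_real_le (f : E.domain) (B : Set K) :
    (E.champMeasure f).real B ≤ 2 * E.form f f := by
  refine (measureReal_mono (Set.subset_univ B)).trans ?_
  rw [measureReal_def]
  exact ENNReal.toReal_le_of_le_ofReal (by have := E.form_nonneg f; positivity)
    (E.champMeasure_univ_le f)

omit [LocallyCompactSpace K] [T2Space K] [SecondCountableTopology K]
  [TopologicalSpace.PseudoMetrizableSpace K] in
lemma integrable_cc (ψ : C_c(K, ℝ)) (m : Measure K) [IsFiniteMeasure m] : Integrable ψ m :=
  ψ.continuous.integrable_of_hasCompactSupport ψ.hasCompactSupport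

/-- Linear relations between energy functionals hold for the measures. -/
lemma sum_champMeasure_eq_zero {ι : Type*} (s : Finset ι) (c : ι → ℝ) (f : ι → E.domain)
    (h : ∀ ψ : C_c(K, ℝ), ∑ i ∈ s, c i * E.energyForm ψ (f i) (f i) = 0) (B : Set K) :
    ∑ i ∈ s, c i * (E.champMeasure (f i)).real B = 0 := by
  -- Splitting the coefficients by sign turns the relation into equality of two finite positive
  -- measures, which integrals of `C_c` functions determine.
  set P : (ι → ℝ) → Measure K := fun d => ∑ i ∈ s, (d i).toNNReal • E.champMeasure (f i) with hP
  have hfin : ∀ d, IsFiniteMeasure (P d) := fun d => by rw [hP]; infer_instance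
  have hint : ∀ (d : ι → ℝ) (ψ : C_c(K, ℝ)), ∫ x, ψ x ∂(P d)
      = ∑ i ∈ s, max (d i) 0 * E.energyForm ψ (f i) (f i) := by
    intro d ψ
    rw [hP, integral_finsetSum_measure (fun i _ => integrable_cc ψ _)]
    refine Finset.sum_congr rfl fun i _ => ?_
    rw [integral_smul_nnreal_measure, integral_champMeasure]
    rfl
  have hreal : ∀ (d : ι → ℝ), (P d).real B
      = ∑ i ∈ s, max (d i) 0 * (E.champMeasure (f i)).real B := by
    intro d
    rw [hP, measureReal_def, Measure.finsetSum_apply, ENNReal.toReal_sum]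
    · refine Finset.sum_congr rfl fun i _ => ?_
      rw [Measure.smul_apply, ENNReal.smul_def, smul_eq_mul, ENNReal.toReal_mul]
      rfl
    · intro i _
      exact measure_ne_top _ _
  have hd : ∀ i, c i = max (c i) 0 - max (-c i) 0 := by
    intro i
    rcases le_total (c i) 0 with h | h <;> simp [h]
  have heq : P c = P (fun i => -c i) := by
    have := hfin c
    have := hfin (fun i => -c i)
    refine Measure.ext_of_integral_eq_on_compactlySupported fun ψ => ?_
    rw [hint, hint, ← sub_eq_zero, ← Finset.sum_sub_distrib]
    refine (Finset.sum_congr rfl fun i _ => ?_).trans (h ψ)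
    rw [← sub_mul, ← hd]
  have h1 := congrArg (fun m => m.real B) heq
  simp only [hreal] at h1
  rw [← sub_eq_zero, ← Finset.sum_sub_distrib] at h1
  rw [← h1]
  refine Finset.sum_congr rfl fun i _ => ?_
  rw [← sub_mul, ← hd]

/-- The polarization of `f ↦ ν_f B`. -/
def setLim (B : Set K) (f g : E.domain) : ℝ :=
  (1 / 2) * ((E.champMeasure (f + g)).real B - (E.champMeasure f).real B
    - (E.champMeasure g).real B)

lemma setLim_symm (B : Set K) (f g : E.domain) : E.setLim B f g = E.setLim B g f := by
  rw [setLim, setLim, add_comm f g]; ring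

/-- For a quadratic form `q` one has `q(f+f'+g) + q(f) + q(f') + q(g) = q(f+f') + q(f+g) + q(f'+g)`.
The identity transfers from the energy forms to the measures. -/
lemma setLim_add_left (B : Set K) (f f' g : E.domain) :
    E.setLim B (f + f') g = E.setLim B f g + E.setLim B f' g := by
  have h := E.sum_champMeasure_eq_zero Finset.univ ![1, 1, 1, 1, -1, -1, -1]
    ![f + f' + g, f, f', g, f + f', f + g, f' + g] (fun ψ => by
      simp only [Fin.sum_univ_succ]
      simp
      rw [E.energyForm_symm ψ g f, E.energyForm_symm ψ g f', E.energyForm_symm ψ f' f]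
      ring) B
  simp only [Fin.sum_univ_succ] at h
  simp at h
  simp only [setLim]
  linarith

lemma setLim_smul_left (B : Set K) (c : ℝ) (f g : E.domain) :
    E.setLim B (c • f) g = c • E.setLim B f g := by
  have h := E.sum_champMeasure_eq_zero Finset.univ ![1, -1, -1, -c, c, c]
    ![c • f + g, c • f, g, f + g, f, g] (fun ψ => by
      simp only [Fin.sum_univ_succ]
      simp
      rw [E.energyForm_symm ψ g f]
      ring) B
  simp only [Fin.sum_univ_succ] at h
  simp at h
  simp only [setLim, smul_eq_mul]
  linarith

/-- The bilinear form `(f, g) ↦ ν_{f, g}(B)`. -/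
def setForm (B : Set K) : LinearMap.BilinForm ℝ E.domain :=
  LinearMap.mk₂ ℝ (E.setLim B) (E.setLim_add_left B) (E.setLim_smul_left B)
    (fun f g g' => by
      rw [E.setLim_symm B f, setLim_add_left, E.setLim_symm B g, E.setLim_symm B g'])
    (fun c f g => by rw [E.setLim_symm B f, setLim_smul_left, E.setLim_symm B g])

lemma setForm_apply (B : Set K) (f g : E.domain) : E.setForm B f g =
    (1 / 2) * ((E.champMeasure (f + g)).real B - (E.champMeasure f).real B
      - (E.champMeasure g).real B) := rfl

lemma setForm_symm (B : Set K) (f g : E.domain) : E.setForm B f g = E.setForm B g f :=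
  E.setLim_symm B f g

lemma setForm_self (B : Set K) (f : E.domain) : E.setForm B f f = (E.champMeasure f).real B := by
  have h := E.sum_champMeasure_eq_zero Finset.univ ![1, -4] ![f + f, f] (fun ψ => by
      simp only [Fin.sum_univ_succ]
      simp
      ring) B
  simp only [Fin.sum_univ_succ] at h
  simp at h
  rw [setForm_apply]
  linarith

lemma setForm_nonneg (B : Set K) (f : E.domain) : 0 ≤ E.setForm B f f := by
  rw [setForm_self]; exact measureReal_nonneg

/-- Convergence in `ℱ` implies setwise convergence of the energy measures. -/
lemma tendsto_champMeasure {g : ℕ → E.domain} {f : E.domain}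
    (h : Tendsto (fun n => formOne E.form (g n - f) (g n - f)) atTop (𝓝 0)) (B : Set K) :
    Tendsto (fun n => E.champMeasure (g n) B) atTop (𝓝 (E.champMeasure f B)) := by
  have h0 : Tendsto (fun n => E.setForm B (g n - f) (g n - f)) atTop (𝓝 0) := by
    have h2 := h.const_mul 2
    rw [mul_zero] at h2
    refine squeeze_zero (fun n => E.setForm_nonneg B _) (fun n => ?_) h2
    rw [setForm_self]
    refine (E.champMeasure_real_le _ B).trans ?_
    rw [formOne_self]
    have := sq_nonneg ‖((g n - f : E.domain) : Lp ℝ 2 μ)‖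
    linarith
  have h1 : Tendsto (fun n => E.setForm B f (g n - f)) atTop (𝓝 0) := by
    rw [tendsto_zero_iff_abs_tendsto_zero]
    have h2 : Tendsto (fun n => √(E.setForm B f f * E.setForm B (g n - f) (g n - f))) atTop
        (𝓝 0) := by
      simpa using (h0.const_mul (E.setForm B f f)).sqrt
    refine squeeze_zero (fun n => abs_nonneg _) (fun n => Real.abs_le_sqrt ?_) h2
    have := LinearMap.BilinForm.apply_mul_apply_le_of_forall_zero_le (E.setForm B)
      (E.setForm_nonneg B) f (g n - f)
    rw [E.setForm_symm B (g n - f) f] at this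
    rwa [sq]
  have h3 : Tendsto (fun n => (E.champMeasure (g n)).real B) atTop
      (𝓝 ((E.champMeasure f).real B)) := by
    have h4 := ((h1.const_mul 2).add h0).const_add (E.setForm B f f)
    simp only [mul_zero, add_zero] at h4
    rw [setForm_self] at h4
    refine h4.congr fun n => ?_
    rw [← E.setForm_self B (g n), ← E.setForm_self B f]
    have e : g n = f + (g n - f) := by abel
    conv_rhs => rw [e]
    rw [map_add, map_add, LinearMap.add_apply, LinearMap.add_apply, E.setForm_symm B (g n - f) f]
    ring
  have h5 := ENNReal.tendsto_ofReal h3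
  simpa [ofReal_measureReal] using h5

lemma isBoundedEnergyMeasure_champMeasure {f : E.domain} (hf : IsBdd (f : Lp ℝ 2 μ)) :
    E.IsBoundedEnergyMeasure f (E.champMeasure f) where
  finite := inferInstance
  bounded := hf
  identity := by
    obtain ⟨s, hs⟩ := E.exists_sq hf
    refine ⟨s, hs, fun g φ hg => ?_⟩
    have hgb : IsBdd (g : Lp ℝ 2 μ) := by
      obtain ⟨C, -, hC⟩ := cc_abs_le φ
      refine ⟨C, ?_⟩
      filter_upwards [hg] with x hx
      rw [hx]; exact hC x
    obtain ⟨u, hu⟩ := E.exists_mul hf hgb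
    have hu' : ∀ᵐ x ∂μ, (u : Lp ℝ 2 μ) x = (f : Lp ℝ 2 μ) x * φ x := by
      filter_upwards [hu, hg] with x h1 h2
      rw [h1, h2]
    exact ⟨u, hu', by rw [integral_champMeasure, E.energyForm_eq hg hs hu']⟩

/-- The defining identity tests only functions of `ℱ ∩ C_c`, but these are uniformly dense in `C_c`
and both measures are finite. -/
lemma IsBoundedEnergyMeasure.eq_champMeasure {f : E.domain} {m : Measure K}
    (h : E.IsBoundedEnergyMeasure f m) : m = E.champMeasure f := by
  have := h.finite
  obtain ⟨s, hs, hid⟩ := h.identity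
  refine Measure.ext_of_integral_eq_on_compactlySupported fun ψ => ?_
  have key : ∀ ε > 0, |∫ x, ψ x ∂m - ∫ x, ψ x ∂(E.champMeasure f)|
      ≤ ε * (m.real Set.univ + (E.champMeasure f).real Set.univ) := by
    intro ε hε
    obtain ⟨g, φ, hg, hφ⟩ := E.regular_continuous ψ ε hε
    obtain ⟨u, hu, he⟩ := hid g φ hg
    have h1 : ∫ x, φ x ∂m = ∫ x, φ x ∂(E.champMeasure f) := by
      rw [he, integral_champMeasure, E.energyForm_eq hg hs hu]
    have h2 : ∀ m' : Measure K, IsFiniteMeasure m' →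
        |∫ x, ψ x ∂m' - ∫ x, φ x ∂m'| ≤ ε * m'.real Set.univ := by
      intro m' _
      rw [← integral_sub (integrable_cc ψ m') (integrable_cc φ m'), ← Real.norm_eq_abs]
      exact norm_integral_le_of_norm_le_const (.of_forall fun x => (hφ x).le)
    have h3 := abs_le.1 (h2 m inferInstance)
    have h4 := abs_le.1 (h2 (E.champMeasure f) inferInstance)
    rw [abs_le, mul_add]
    constructor <;> linarith [h3.1, h3.2, h4.1, h4.2]
  set A := m.real Set.univ + (E.champMeasure f).real Set.univ with hA
  have hA0 : 0 ≤ A := add_nonneg measureReal_nonneg measureReal_nonneg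
  have hz : |∫ x, ψ x ∂m - ∫ x, ψ x ∂(E.champMeasure f)| ≤ 0 := by
    refine le_of_forall_pos_le_add fun ε hε => ?_
    refine (key (ε / (A + 1)) (by positivity)).trans ?_
    rw [zero_add, div_mul_eq_mul_div, div_le_iff₀ (by positivity)]
    nlinarith
  exact sub_eq_zero.1 (abs_eq_zero.1 (le_antisymm hz (abs_nonneg _)))

/-- Regularity supplies approximants in `ℱ ∩ C_c`; these are bounded, so their measures satisfy the
defining identity and converge setwise. -/
lemma isEnergyMeasure_champMeasure (f : E.domain) : E.IsEnergyMeasure f (E.champMeasure f) := by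
  refine ⟨inferInstance, ?_⟩
  choose g φ hg hφ using fun n : ℕ => E.regular_domain f (1 / ((n : ℝ) + 1)) (by positivity)
  have hb : ∀ n, IsBdd (g n : Lp ℝ 2 μ) := by
    intro n
    obtain ⟨C, -, hC⟩ := cc_abs_le (φ n)
    refine ⟨C, ?_⟩
    filter_upwards [hg n] with x hx
    rw [hx]; exact hC x
  have ht : Tendsto (fun n => formOne E.form (g n - f) (g n - f)) atTop (𝓝 0) := by
    refine squeeze_zero (fun n => ?_) (fun n => ?_) tendsto_one_div_add_atTop_nhds_zero_nat
    · rw [formOne_self]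
      have := E.form_nonneg (g n - f)
      positivity
    · have e : formOne E.form (g n - f) (g n - f) = formOne E.form (f - g n) (f - g n) := by
        rw [formOne_self, formOne_self, ← neg_sub f (g n), map_neg, map_neg, LinearMap.neg_apply,
          neg_neg, Submodule.coe_neg, norm_neg]
      rw [e]
      exact (hφ n).le
  exact ⟨g, fun n => E.champMeasure (g n),
    fun n => E.isBoundedEnergyMeasure_champMeasure (hb n), ht,
    fun B _ => E.tendsto_champMeasure ht B⟩

lemma IsEnergyMeasure.eq_champMeasure {f : E.domain} {m : Measure K}
    (h : E.IsEnergyMeasure f m) : m = E.champMeasure f := by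
  obtain ⟨-, g, mg, hmg, hg, hB⟩ := h
  ext B hBm
  have h1 := hB B hBm
  simp only [(hmg _).eq_champMeasure] at h1
  exact tendsto_nhds_unique h1 (E.tendsto_champMeasure hg B)

/-- The energy measure of `f` is the measure given by the energy functional. -/
lemma energyMeasure_eq_champMeasure (f : E.domain) : E.energyMeasure f = E.champMeasure f := by
  have h : ∃ m, E.IsEnergyMeasure f m := ⟨_, E.isEnergyMeasure_champMeasure f⟩
  rw [energyMeasure, dif_pos h]
  exact h.choose_spec.eq_champMeasure

lemma mutualEnergyMeasure_apply (f g : E.domain) {B : Set K} (hB : MeasurableSet B) :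
    E.mutualEnergyMeasure f g B = E.setForm B f g := by
  rw [mutualEnergyMeasure, setForm_apply]
  simp only [energyMeasure_eq_champMeasure]
  simp [Measure.toSignedMeasure_apply_measurable hB]

end

end RegularDirichletForm

end

/-! ### Densities of mutual energy measures and the pointwise index as a supremum of ranks -/

noncomputable section

/-- Symmetric positive semidefinite kernels on an index set. -/
structure IsPSDKernel {ι : Type*} (R : ι → ι → ℝ) : Prop where
  symm : ∀ i j, R i j = R j i
  nonneg : ∀ (s : Finset ι) (a : ι → ℝ), 0 ≤ ∑ i ∈ s, ∑ j ∈ s, a i * a j * R i j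

namespace IsPSDKernel

variable {ι : Type*} {R : ι → ι → ℝ}

lemma diag_nonneg (h : IsPSDKernel R) (i : ι) : 0 ≤ R i i := by
  simpa using h.nonneg {i} 1

lemma sq_le (h : IsPSDKernel R) (i j : ι) : R i j ^ 2 ≤ R i i * R j j := by
  classical
  by_cases hij : i = j
  · subst hij; exact (sq _).le
  · have key : ∀ t : ℝ, 0 ≤ R i i * (t * t) + 2 * R i j * t + R j j := by
      intro t
      have := h.nonneg {i, j} (fun k => if k = i then t else 1)
      simp [Finset.sum_pair hij, Ne.symm hij, h.symm j i] at this
      linarith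
    have := discrim_le_zero key
    rw [discrim] at this
    linarith

end IsPSDKernel

section Rank

lemma isOpen_le_rank (m n r : ℕ) : IsOpen {M : Matrix (Fin m) (Fin n) ℝ | r ≤ M.rank} := by
  set L : Matrix (Fin m) (Fin n) ℝ →ₗ[ℝ] ((Fin n → ℝ) →L[ℝ] (Fin m → ℝ)) :=
    LinearMap.toContinuousLinearMap.toLinearMap ∘ₗ Matrix.toLin'.toLinearMap with hL
  have hc : Continuous L := L.continuous_of_finiteDimensional
  have h := (isOpen_setOfPred_nat_le_rank (𝕜 := ℝ) (E := Fin n → ℝ)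
    (F := Fin m → ℝ) r).preimage hc
  convert! h using 1
  ext M
  have e : ((L M : (Fin n → ℝ) →L[ℝ] (Fin m → ℝ)) : (Fin n → ℝ) →ₗ[ℝ] (Fin m → ℝ))
      = M.mulVecLin := rfl
  simp only [Set.mem_ofPred_eq, Set.mem_preimage]
  rw [e, Matrix.rank, LinearMap.rank, ← Module.finrank_eq_rank]
  exact Nat.cast_le.symm

lemma rank_le_of_tendsto {m n : ℕ} {M : ℕ → Matrix (Fin m) (Fin n) ℝ}
    {A : Matrix (Fin m) (Fin n) ℝ} (h : ∀ i j, Tendsto (fun k => M k i j) atTop (𝓝 (A i j)))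
    {q : ℕ∞} (hq : ∀ k, ((M k).rank : ℕ∞) ≤ q) : (A.rank : ℕ∞) ≤ q := by
  have h1 : Tendsto M atTop (𝓝 A) := by
    refine tendsto_pi_nhds.2 fun i => tendsto_pi_nhds.2 fun j => h i j
  have h2 := h1.eventually ((isOpen_le_rank m n A.rank).mem_nhds (le_refl A.rank))
  obtain ⟨k, hk⟩ := h2.exists
  exact le_trans (Nat.cast_le.2 hk) (hq k)

lemma measurable_rank {X : Type*} [MeasurableSpace X] {m n : ℕ} {R : Fin m → Fin n → X → ℝ}
    (hR : ∀ i j, Measurable (R i j)) :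
    Measurable fun x => (Matrix.of fun i j => R i j x).rank := by
  refine measurable_of_Ici fun r => ?_
  have h1 : Measurable fun x => fun i j => R i j x :=
    measurable_pi_lambda _ fun i => measurable_pi_lambda _ fun j => hR i j
  have h2 : MeasurableSet {M : Fin m → Fin n → ℝ | r ≤ (Matrix.of M).rank} :=
    IsOpen.measurableSet (α := Fin m → Fin n → ℝ) (isOpen_le_rank m n r)
  exact h1 h2

end Rank

namespace RegularDirichletForm

variable {K : Type*} [TopologicalSpace K] [MeasurableSpace K] {μ : Measure K}

/-- The density of the mutual energy measure. -/
def density (E : RegularDirichletForm μ) (ν : Measure K) (f g : E.domain) : K → ℝ :=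
  (E.mutualEnergyMeasure f g).rnDeriv ν

lemma measurable_density (E : RegularDirichletForm μ) (ν : Measure K) (f g : E.domain) :
    Measurable (E.density ν f g) := SignedMeasure.measurable_rnDeriv _ _

lemma integrable_density (E : RegularDirichletForm μ) (ν : Measure K) (f g : E.domain) :
    Integrable (E.density ν f g) ν := SignedMeasure.integrable_rnDeriv _ _

variable [LocallyCompactSpace K] [T2Space K] [BorelSpace K] [SecondCountableTopology K]
  [TopologicalSpace.PseudoMetrizableSpace K] [SigmaFinite μ]
  (E : RegularDirichletForm μ) {ν : Measure K} [SigmaFinite ν]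

section

variable {E}

/-- The signed measure is a combination of finite measures dominated by `ν`, so the same combination
of their derivatives is its density, with singular part zero. -/
lemma setIntegral_density (hν : ∀ f : E.domain, E.energyMeasure f ≪ ν) (f g : E.domain)
    {B : Set K} : ∫ x in B, E.density ν f g x ∂ν = E.setForm B f g := by
  set d : E.domain → K → ℝ := fun f x => ((E.energyMeasure f).rnDeriv ν x).toReal with hd
  have hdi : ∀ f, Integrable (d f) ν := fun f => Measure.integrable_toReal_rnDeriv
  have hdB : ∀ f, ∀ B : Set K, ∫ x in B, d f x ∂ν = (E.champMeasure f).real B := fun f B => by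
    rw [← E.energyMeasure_eq_champMeasure f]
    exact Measure.setIntegral_toReal_rnDeriv (hν f) B
  set h : K → ℝ := fun x => (1 / 2) * (d (f + g) x - d f x - d g x) with hh
  have hhi : Integrable h ν := (((hdi _).sub (hdi _)).sub (hdi _)).const_mul _
  have hhB : ∀ B : Set K, ∫ x in B, h x ∂ν = E.setForm B f g := by
    intro B
    rw [hh, integral_const_mul, integral_sub
      (f := fun x => d (f + g) x - d f x) ((hdi _).sub (hdi _)).restrict
      (hdi _).restrict, integral_sub (hdi _).restrict (hdi _).restrict,
      hdB, hdB, hdB, setForm_apply]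
  have he : h =ᵐ[ν] E.density ν f g := by
    refine SignedMeasure.eq_rnDeriv (s := E.mutualEnergyMeasure f g) 0 h hhi
      VectorMeasure.MutuallySingular.zero_left ?_
    rw [zero_add]
    ext B hB
    rw [withDensityᵥ_apply hhi hB, hhB, E.mutualEnergyMeasure_apply f g hB]
  rw [← hhB B]
  exact integral_congr_ae (ae_restrict_of_ae (he.symm))

/-- Every algebraic identity of the bilinear forms `setForm B` becomes an almost everywhere identity
of densities through this lemma. -/
lemma density_unique (hν : ∀ f : E.domain, E.energyMeasure f ≪ ν) {f g : E.domain} {h : K → ℝ}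
    (hi : Integrable h ν)
    (hB : ∀ B, MeasurableSet B → ∫ x in B, h x ∂ν = E.setForm B f g) :
    ∀ᵐ x ∂ν, E.density ν f g x = h x :=
  (E.integrable_density ν f g).ae_eq_of_forall_setIntegral_eq _ _ hi fun B hBm _ => by
    rw [setIntegral_density hν f g, hB B hBm]

lemma density_symm (f g : E.domain) (x : K) : E.density ν f g x = E.density ν g f x := by
  have : E.mutualEnergyMeasure f g = E.mutualEnergyMeasure g f := by
    simp only [mutualEnergyMeasure, show f + g = g + f from add_comm f g]
    rw [sub_right_comm]
  rw [density, density, this]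

lemma density_sum_sum (hν : ∀ f : E.domain, E.energyMeasure f ≪ ν) {ι κ : Type*}
    (s : Finset ι) (t : Finset κ) (a : ι → ℝ) (b : κ → ℝ) (f : ι → E.domain) (g : κ → E.domain) :
    ∀ᵐ x ∂ν, E.density ν (∑ i ∈ s, a i • f i) (∑ j ∈ t, b j • g j) x
      = ∑ i ∈ s, ∑ j ∈ t, a i * b j * E.density ν (f i) (g j) x := by
  have hi : ∀ i ∈ s, Integrable (fun x => ∑ j ∈ t, a i * b j * E.density ν (f i) (g j) x) ν :=
    fun i _ => integrable_finsetSum _ fun j _ => (E.integrable_density ν _ _).const_mul _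
  refine density_unique hν (integrable_finsetSum _ hi) fun B hB => ?_
  rw [integral_finsetSum _ fun i h => (hi i h).restrict]
  simp only [map_sum, map_smul, LinearMap.sum_apply, LinearMap.smul_apply, Finset.smul_sum]
  rw [Finset.sum_comm (s := t)]
  refine Finset.sum_congr rfl fun i _ => ?_
  rw [integral_finsetSum _ fun j _ => ((E.integrable_density ν _ _).const_mul _).restrict]
  refine Finset.sum_congr rfl fun j _ => ?_
  rw [integral_const_mul, setIntegral_density hν _ _, smul_eq_mul, smul_eq_mul]
  ring

lemma density_sub_left (hν : ∀ f : E.domain, E.energyMeasure f ≪ ν) (f f' g : E.domain) :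
    ∀ᵐ x ∂ν, E.density ν (f - f') g x = E.density ν f g x - E.density ν f' g x :=
  density_unique hν ((E.integrable_density ν _ _).sub (E.integrable_density ν _ _)) fun B hB => by
    rw [integral_sub (E.integrable_density ν _ _).restrict (E.integrable_density ν _ _).restrict,
      setIntegral_density hν _ _, setIntegral_density hν _ _, map_sub, LinearMap.sub_apply]

lemma density_self_nonneg (hν : ∀ f : E.domain, E.energyMeasure f ≪ ν) (f : E.domain) :
    ∀ᵐ x ∂ν, 0 ≤ E.density ν f f x :=
  ae_nonneg_of_forall_setIntegral_nonneg (E.integrable_density ν f f) fun B hB _ => by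
    rw [setIntegral_density hν _ _]; exact E.setForm_nonneg B f

lemma integral_density_self_le (hν : ∀ f : E.domain, E.energyMeasure f ≪ ν) (f : E.domain) :
    ∫ x, E.density ν f f x ∂ν ≤ 2 * E.form f f := by
  rw [← setIntegral_univ, setIntegral_density hν _ _, setForm_self]
  exact E.champMeasure_real_le f _

/-- The matrices of densities are positive semidefinite almost everywhere. -/
lemma ae_isPSDKernel_density (hν : ∀ f : E.domain, E.energyMeasure f ≪ ν) {ι : Type*} [Countable ι]
    (f : ι → E.domain) : ∀ᵐ x ∂ν, IsPSDKernel fun i j => E.density ν (f i) (f j) x := by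
  -- Finite subsets and rational coefficients form a countable family, so one null set serves them
  -- all; real coefficients follow by density.
  have key : ∀ (s : Finset ι) (a : s → ℚ), ∀ᵐ x ∂ν,
      0 ≤ ∑ i : s, ∑ j : s, (a i : ℝ) * a j * E.density ν (f i) (f j) x := by
    intro s a
    filter_upwards [density_sum_sum hν Finset.univ Finset.univ (fun i : s => (a i : ℝ))
      (fun i : s => (a i : ℝ)) (fun i : s => f i) (fun i : s => f i),
      density_self_nonneg hν (∑ i : s, (a i : ℝ) • f i)] with x h1 h2
    rwa [h1] at h2
  have key' : ∀ᵐ x ∂ν, ∀ (s : Finset ι) (a : s → ℚ),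
      0 ≤ ∑ i : s, ∑ j : s, (a i : ℝ) * a j * E.density ν (f i) (f j) x := by
    rw [ae_all_iff]; intro s
    rw [ae_all_iff]; exact key s
  filter_upwards [key'] with x hx
  refine ⟨fun i j => density_symm _ _ _, fun s a => ?_⟩
  have hd : DenseRange (fun (a : s → ℚ) (i : s) => (a i : ℝ)) :=
    DenseRange.piMap fun _ => Rat.denseRange_cast
  have h1 := hd.induction_on
    (p := fun b : s → ℝ => 0 ≤ ∑ i : s, ∑ j : s, b i * b j * E.density ν (f i) (f j) x)
    (fun i => a i) (isClosed_le continuous_const (by fun_prop)) (hx s)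
  rw [← Finset.sum_coe_sort]
  simp only [← Finset.sum_coe_sort s]
  exact h1

lemma density_sq_le (hν : ∀ f : E.domain, E.energyMeasure f ≪ ν) (f g : E.domain) :
    ∀ᵐ x ∂ν, E.density ν f g x ^ 2 ≤ E.density ν f f x * E.density ν g g x := by
  filter_upwards [ae_isPSDKernel_density hν ![f, g]] with x hx
  simpa using hx.sq_le 0 1

/-- The integrals of the densities are summable, so the series of densities converges almost
everywhere and its terms tend to zero, without passing to a subsequence. -/
lemma ae_tendsto_density_zero (hν : ∀ f : E.domain, E.energyMeasure f ≪ ν) {e : ℕ → E.domain}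
    (he : ∀ n, formOne E.form (e n) (e n) ≤ (1 / 2) ^ n) :
    ∀ᵐ x ∂ν, Tendsto (fun n => E.density ν (e n) (e n) x) atTop (𝓝 0) := by
  have h1 : ∫⁻ x, ∑' n, ENNReal.ofReal (E.density ν (e n) (e n) x) ∂ν ≠ ⊤ := by
    rw [lintegral_tsum fun n => (E.measurable_density ν _ _).ennreal_ofReal.aemeasurable]
    have h2 : ∀ n, ∫⁻ x, ENNReal.ofReal (E.density ν (e n) (e n) x) ∂ν
        ≤ ENNReal.ofReal (2 * (1 / 2) ^ n) := by
      intro n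
      rw [← ofReal_integral_eq_lintegral_ofReal (E.integrable_density ν _ _)
        (density_self_nonneg hν _)]
      refine ENNReal.ofReal_le_ofReal ((integral_density_self_le hν _).trans ?_)
      have := he n
      rw [formOne_self] at this
      have := sq_nonneg ‖(e n : Lp ℝ 2 μ)‖
      linarith
    refine ne_top_of_le_ne_top ?_ (ENNReal.tsum_le_tsum h2)
    rw [← ENNReal.ofReal_tsum_of_nonneg (fun n => by positivity)
      (summable_geometric_two.mul_left 2)]
    exact ENNReal.ofReal_ne_top
  have h3 := ae_lt_top (Measurable.tsum fun n =>
    (E.measurable_density ν (e n) (e n)).ennreal_ofReal) h1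
  filter_upwards [h3, ae_all_iff.2 fun n => density_self_nonneg hν (e n)] with x hx hx0
  have h4 := ENNReal.tendsto_atTop_zero_of_tsum_ne_top hx.ne
  have h5 := (ENNReal.tendsto_toReal ENNReal.zero_ne_top).comp h4
  simpa [Function.comp_def, ENNReal.toReal_ofReal (hx0 _)] using h5

end

/-- The supremum of the ranks of the matrices of densities of the first members of a sequence. -/
def rankSup (ν : Measure K) (f : ℕ → E.domain) (x : K) : ℕ∞ :=
  ⨆ N : ℕ, ((Matrix.of fun i j : Fin N => E.density ν (f i) (f j) x).rank : ℕ∞)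

lemma measurable_rankSup (f : ℕ → E.domain) : Measurable (E.rankSup ν f) := by
  have : BorelSpace ℕ∞ := ⟨borel_eq_top_of_countable.symm⟩
  exact Measurable.iSup fun _ => Measurable.of_discrete.comp
    (measurable_rank fun _ _ => E.measurable_density ν _ _)

variable {E}

/-- Only finitely many `f k` occur, so bilinearity writes the matrix as `A Z Aᵀ` with `Z` a leading
section. -/
lemma rank_le_rankSup_of_mem_span (hν : ∀ f : E.domain, E.energyMeasure f ≪ ν)
    (f : ℕ → E.domain) {N : ℕ} {h : Fin N → E.domain}
    (hh : ∀ i, h i ∈ Submodule.span ℝ (Set.range f)) :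
    ∀ᵐ x ∂ν, ((Matrix.of fun i j => E.density ν (h i) (h j) x).rank : ℕ∞) ≤ E.rankSup ν f x := by
  choose c hc using fun i => Finsupp.mem_span_range_iff_exists_finsupp.1 (hh i)
  obtain ⟨m, hm⟩ : ∃ m, ∀ i, ∀ k ∈ (c i).support, k < m := by
    refine ⟨(Finset.univ.biUnion fun i => (c i).support).sup id + 1, fun i k hk => ?_⟩
    exact Nat.lt_succ_of_le (Finset.le_sup (f := id)
      (Finset.mem_biUnion.2 ⟨i, Finset.mem_univ _, hk⟩))
  have hsum : ∀ i, h i = ∑ k : Fin m, c i k • f k := by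
    intro i
    rw [← hc i, Finsupp.sum, Fin.sum_univ_eq_sum_range (fun k => c i k • f k) m]
    refine Finset.sum_subset (fun k hk => Finset.mem_range.2 (hm i k hk)) fun k _ hk => ?_
    rw [Finsupp.notMem_support_iff.1 hk, zero_smul]
  have hae : ∀ᵐ x ∂ν, ∀ i j, E.density ν (h i) (h j) x
      = ∑ k : Fin m, ∑ l : Fin m, c i k * c j l * E.density ν (f k) (f l) x := by
    rw [ae_all_iff]; intro i
    rw [ae_all_iff]; intro j
    rw [hsum i, hsum j]
    exact density_sum_sum hν _ _ (fun k : Fin m => c i k) (fun k : Fin m => c j k) _ _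
  filter_upwards [hae] with x hx
  set A : Matrix (Fin N) (Fin m) ℝ := Matrix.of fun i k => c i k with hA
  set Z : Matrix (Fin m) (Fin m) ℝ := Matrix.of fun k l => E.density ν (f k) (f l) x with hZ
  have e : (Matrix.of fun i j => E.density ν (h i) (h j) x) = A * (Z * A.transpose) := by
    ext i j
    rw [Matrix.of_apply, hx, Matrix.mul_apply]
    refine Finset.sum_congr rfl fun k _ => ?_
    rw [Matrix.mul_apply, Finset.mul_sum]
    refine Finset.sum_congr rfl fun l _ => ?_
    simp only [hA, hZ, Matrix.of_apply, Matrix.transpose_apply]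
    ring
  rw [e]
  refine le_trans (Nat.cast_le.2 ((Matrix.rank_mul_le_right _ _).trans
    (Matrix.rank_mul_le_left _ _))) ?_
  exact le_iSup (fun N : ℕ =>
    ((Matrix.of fun i j : Fin N => E.density ν (f i) (f j) x).rank : ℕ∞)) m

/-- Span elements approximating `g i` at rate `2⁻ⁿ` have density matrices converging almost
everywhere, by Cauchy–Schwarz for densities; lower semicontinuity of the rank finishes. -/
lemma boundsRank_rankSup (hν : ∀ f : E.domain, E.energyMeasure f ≪ ν) {f : ℕ → E.domain}
    (hf : E.HasDenseSpan f) : E.BoundsRank ν (E.rankSup ν f) := by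
  intro N g
  choose h hh hlt using fun (i : Fin N) (n : ℕ) => hf (g i) ((1 / 2) ^ n) (by positivity)
  have h1 : ∀ᵐ x ∂ν, ∀ n, ((Matrix.of fun i j => E.density ν (h i n) (h j n) x).rank : ℕ∞)
      ≤ E.rankSup ν f x :=
    ae_all_iff.2 fun n => rank_le_rankSup_of_mem_span hν f fun i => hh i n
  have h2 : ∀ᵐ x ∂ν, ∀ i, Tendsto (fun n => E.density ν (g i - h i n) (g i - h i n) x) atTop
      (𝓝 0) :=
    ae_all_iff.2 fun i => ae_tendsto_density_zero hν fun n => (hlt i n).le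
  have h3 : ∀ᵐ x ∂ν, ∀ i j n, E.density ν (h i n) (h j n) x = E.density ν (g i) (g j) x
      - E.density ν (g i) (g j - h j n) x - E.density ν (g j) (g i - h i n) x
      + E.density ν (g i - h i n) (g j - h j n) x := by
    rw [ae_all_iff]; intro i
    rw [ae_all_iff]; intro j
    rw [ae_all_iff]; intro n
    filter_upwards [density_sub_left hν (g i) (h i n) (g j - h j n),
      density_sub_left hν (g j) (h j n) (h i n), density_sub_left hν (g i) (h i n) (g j)]
      with x a1 a2 a3
    rw [density_symm (g j) (g i - h i n), a1, a3, density_symm (h i n) (g j - h j n), a2,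
      density_symm (h i n) (g j), density_symm (h i n) (h j n)]
    ring
  have h4 : ∀ᵐ x ∂ν, ∀ i j n, E.density ν (g i) (g j - h j n) x ^ 2
      ≤ E.density ν (g i) (g i) x * E.density ν (g j - h j n) (g j - h j n) x := by
    rw [ae_all_iff]; intro i
    rw [ae_all_iff]; intro j
    rw [ae_all_iff]; intro n
    exact density_sq_le hν _ _
  have h5 : ∀ᵐ x ∂ν, ∀ i j n, E.density ν (g i - h i n) (g j - h j n) x ^ 2
      ≤ E.density ν (g i - h i n) (g i - h i n) x
        * E.density ν (g j - h j n) (g j - h j n) x := by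
    rw [ae_all_iff]; intro i
    rw [ae_all_iff]; intro j
    rw [ae_all_iff]; intro n
    exact density_sq_le hν _ _
  filter_upwards [h1, h2, h3, h4, h5] with x x1 x2 x3 x4 x5
  have aux : ∀ u v : ℕ → ℝ, (∀ n, u n ^ 2 ≤ v n) → Tendsto v atTop (𝓝 0) →
      Tendsto u atTop (𝓝 0) := by
    intro u v huv hv
    rw [tendsto_zero_iff_abs_tendsto_zero]
    refine squeeze_zero (fun n => abs_nonneg _) (fun n => Real.abs_le_sqrt (huv n)) ?_
    simpa using hv.sqrt
  refine rank_le_of_tendsto (M := fun n => Matrix.of fun i j => E.density ν (h i n) (h j n) x)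
    (fun i j => ?_) x1
  have t1 := aux _ _ (x4 i j) (by simpa using (x2 j).const_mul (E.density ν (g i) (g i) x))
  have t2 := aux _ _ (x4 j i) (by simpa using (x2 i).const_mul (E.density ν (g j) (g j) x))
  have t3 := aux _ _ (x5 i j) (by simpa using (x2 i).mul (x2 j))
  simp only [Matrix.of_apply]
  have t4 := (((tendsto_const_nhds (x := E.density ν (g i) (g j) x)).sub t1).sub t2).add t3
  simp only [sub_zero, add_zero] at t4
  exact t4.congr fun n => (x3 i j n).symm

lemma isPointwiseIndex_rankSup (hν : ∀ f : E.domain, E.energyMeasure f ≪ ν) {f : ℕ → E.domain}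
    (hf : E.HasDenseSpan f) : E.IsPointwiseIndex ν (E.rankSup ν f) where
  measurable := E.measurable_rankSup f
  boundsRank := boundsRank_rankSup hν hf
  minimal q' hq' := by
    filter_upwards [ae_all_iff.2 fun N => hq' N fun i : Fin N => f i] with x hx
    exact iSup_le hx

/-- The pointwise index is the supremum of the ranks of the matrices of densities of a sequence
with dense span. -/
lemma pointwiseIndex_ae_eq_rankSup (hν : ∀ f : E.domain, E.energyMeasure f ≪ ν) {f : ℕ → E.domain}
    (hf : E.HasDenseSpan f) : ∀ᵐ x ∂ν, E.pointwiseIndex ν x = E.rankSup ν f x := by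
  have hq := isPointwiseIndex_rankSup hν hf
  -- Existence rules out the default value in `pointwiseIndex`; minimality on both sides gives
  -- equality.
  have h : ∃ q, E.IsPointwiseIndex ν q := ⟨_, hq⟩
  have hp : E.IsPointwiseIndex ν (E.pointwiseIndex ν) := by
    rw [pointwiseIndex, dif_pos h]; exact h.choose_spec
  filter_upwards [hp.minimal _ hq.boundsRank, hq.minimal _ hp.boundsRank] with x h1 h2
  exact le_antisymm h1 h2

lemma index_le_iff (p : ℕ∞) : E.index ν ≤ p ↔ ∀ᵐ x ∂ν, E.pointwiseIndex ν x ≤ p := by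
  constructor
  · intro h
    filter_upwards [ae_le_essSup (μ := ν) (f := E.pointwiseIndex ν)] with x hx
    exact hx.trans h
  · exact fun h => essSup_le_of_ae_le _ h

end RegularDirichletForm

end

/-! ### Measurable pivoted Cholesky elimination for positive semidefinite kernels -/

noncomputable section

namespace IsPSDKernel

variable {ι : Type*} {R : ι → ι → ℝ}

/-- The bilinear form on finitely supported functions given by a kernel. -/
def gram (R : ι → ι → ℝ) : LinearMap.BilinForm ℝ (ι →₀ ℝ) :=
  Finsupp.linearCombination ℝ fun i => Finsupp.linearCombination ℝ (R i)

lemma gram_sum_sum (s t : Finset ι) (a b : ι → ℝ) :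
    gram R (∑ i ∈ s, Finsupp.single i (a i)) (∑ j ∈ t, Finsupp.single j (b j))
      = ∑ i ∈ s, ∑ j ∈ t, a i * b j * R i j := by
  simp only [gram, map_sum, LinearMap.sum_apply, Finsupp.linearCombination_single,
    LinearMap.smul_apply, smul_eq_mul]
  rw [Finset.sum_comm]
  simp only [mul_assoc]

lemma gram_nonneg (h : IsPSDKernel R) (c : ι →₀ ℝ) : 0 ≤ gram R c c := by
  have e : c = ∑ i ∈ c.support, Finsupp.single i (c i) := (Finsupp.sum_single c).symm
  rw [e, gram_sum_sum]
  exact h.nonneg _ _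

/-- Cauchy–Schwarz for a combination and a single index. -/
lemma sum_sq_le (h : IsPSDKernel R) (s : Finset ι) (a : ι → ℝ) (k : ι) :
    (∑ i ∈ s, a i * R i k) ^ 2 ≤ (∑ i ∈ s, ∑ j ∈ s, a i * a j * R i j) * R k k := by
  have h1 := LinearMap.BilinForm.apply_mul_apply_le_of_forall_zero_le (gram R) h.gram_nonneg
    (∑ i ∈ s, Finsupp.single i (a i)) (∑ j ∈ {k}, Finsupp.single j ((fun _ => 1) j))
  simp only [gram_sum_sum] at h1
  simp only [Finset.sum_singleton, mul_one, one_mul, h.symm k] at h1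
  rwa [sq]

end IsPSDKernel

namespace Kernel

/-- The second alternative makes the search total: without a positive diagonal entry it returns 0,
and the conventions for square roots and division by zero make the step trivial. -/
lemma exists_pivot (R : ℕ → ℕ → ℝ) : ∃ k, 0 < R k k ∨ ∀ l, ¬ 0 < R l l := by
  by_cases h : ∃ k, 0 < R k k
  · exact h.imp fun _ => Or.inl
  · push Not at h
    exact ⟨0, Or.inr fun l => not_lt.2 (h l)⟩

open Classical in
/-- The first index with positive diagonal entry, if there is one. -/
def pivot (R : ℕ → ℕ → ℝ) : ℕ := Nat.find (exists_pivot R)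

/-- The normalized column of a kernel at the pivot; it is zero if there is no pivot. -/
def pivotCol (R : ℕ → ℕ → ℝ) (i : ℕ) : ℝ := R i (pivot R) / √(R (pivot R) (pivot R))

/-- One step of the Cholesky elimination. -/
def eliminate (R : ℕ → ℕ → ℝ) : ℕ → ℕ → ℝ := fun i j => R i j - pivotCol R i * pivotCol R j

/-- The kernel after `m` elimination steps. -/
def residual (R : ℕ → ℕ → ℝ) : ℕ → ℕ → ℕ → ℝ
  | 0 => R
  | m + 1 => eliminate (residual R m)

/-- The column that is used in elimination step `m`. -/
def factor (R : ℕ → ℕ → ℝ) (m : ℕ) : ℕ → ℝ := pivotCol (residual R m)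

/-- The pivot of elimination step `m`. -/
def pivotAt (R : ℕ → ℕ → ℝ) (m : ℕ) : ℕ := pivot (residual R m)

variable {R : ℕ → ℕ → ℝ}

lemma diag_nonpos_of_pivot (h : ¬ 0 < R (pivot R) (pivot R)) (l : ℕ) : ¬ 0 < R l l := by
  classical
  have := Nat.find_spec (exists_pivot R)
  exact (this.resolve_left h) l

lemma pivotCol_eq_zero (h : ¬ 0 < R (pivot R) (pivot R)) (i : ℕ) : pivotCol R i = 0 := by
  rw [pivotCol, Real.sqrt_eq_zero_of_nonpos (not_lt.1 h), div_zero]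

lemma eliminate_of_no_pivot (h : ¬ 0 < R (pivot R) (pivot R)) : eliminate R = R := by
  funext i j
  rw [eliminate, pivotCol_eq_zero h, zero_mul, sub_zero]

lemma eq_zero_of_no_pivot (hR : IsPSDKernel R) (h : ¬ 0 < R (pivot R) (pivot R)) (i j : ℕ) :
    R i j = 0 := by
  have h1 := hR.sq_le i j
  have h2 : R i i = 0 := le_antisymm (not_lt.1 (diag_nonpos_of_pivot h i)) (hR.diag_nonneg i)
  rw [h2, zero_mul] at h1
  exact pow_eq_zero_iff two_ne_zero |>.1 (le_antisymm h1 (sq_nonneg _))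

/-- The new kernel is a Schur complement; its nonnegativity is Cauchy–Schwarz against the pivot
index. -/
lemma isPSDKernel_eliminate (hR : IsPSDKernel R) : IsPSDKernel (eliminate R) := by
  by_cases h : 0 < R (pivot R) (pivot R)
  · refine ⟨fun i j => by rw [eliminate, eliminate, hR.symm i j, mul_comm], fun s a => ?_⟩
    have e : ∑ i ∈ s, ∑ j ∈ s, a i * a j * eliminate R i j
        = ∑ i ∈ s, ∑ j ∈ s, a i * a j * R i j
          - (∑ i ∈ s, a i * R i (pivot R)) ^ 2 / R (pivot R) (pivot R) := by
      rw [sq, Finset.sum_mul_sum, Finset.sum_div, ← Finset.sum_sub_distrib]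
      refine Finset.sum_congr rfl fun i _ => ?_
      rw [Finset.sum_div, ← Finset.sum_sub_distrib]
      refine Finset.sum_congr rfl fun j _ => ?_
      rw [eliminate, pivotCol, pivotCol, div_mul_div_comm, Real.mul_self_sqrt h.le]
      ring
    rw [e, sub_nonneg, div_le_iff₀ h]
    exact hR.sum_sq_le s a _
  · rwa [eliminate_of_no_pivot h]

lemma isPSDKernel_residual (hR : IsPSDKernel R) (m : ℕ) : IsPSDKernel (residual R m) := by
  induction m with
  | zero => exact hR
  | succ m ih => exact isPSDKernel_eliminate ih

lemma eq_residual_add_sum (m i j : ℕ) :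
    R i j = residual R m i j + ∑ l ∈ Finset.range m, factor R l i * factor R l j := by
  induction m with
  | zero => simp [residual]
  | succ m ih =>
    rw [Finset.sum_range_succ, residual, eliminate]
    simp only [factor] at ih ⊢
    linarith

/-- `m` is a step in which a pivot exists. -/
def HasPivotAt (R : ℕ → ℕ → ℝ) (m : ℕ) : Prop :=
  0 < residual R m (pivotAt R m) (pivotAt R m)

/-- A step without pivot leaves the kernel unchanged, so elimination is stationary from then on. -/
lemma HasPivotAt.of_le {l m : ℕ} (h : HasPivotAt R m) (hlm : l ≤ m) : HasPivotAt R l := by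
  by_contra hl
  have key : ∀ n, residual R (l + n) = residual R l := by
    intro n
    induction n with
    | zero => rfl
    | succ n ih =>
      rw [← add_assoc, residual, ih]
      exact eliminate_of_no_pivot hl
  obtain ⟨n, rfl⟩ := Nat.exists_eq_add_of_le hlm
  refine hl ?_
  rw [HasPivotAt, pivotAt, key n] at h
  exact h

/-- A step clears the column of its own pivot, and later steps subtract products that vanish there.
-/
lemma residual_pivotAt (hR : IsPSDKernel R) {l m : ℕ} (hl : HasPivotAt R l) (hlm : l < m) (i : ℕ) :
    residual R m i (pivotAt R l) = 0 := by
  induction m, hlm using Nat.le_induction generalizing i with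
  | base =>
    rw [residual, eliminate, pivotCol, pivotCol, div_mul_div_comm]
    change residual R l i (pivotAt R l) - residual R l i (pivotAt R l)
      * residual R l (pivotAt R l) (pivotAt R l) / (√(residual R l (pivotAt R l) (pivotAt R l))
        * √(residual R l (pivotAt R l) (pivotAt R l))) = 0
    rw [Real.mul_self_sqrt hl.le, mul_div_assoc, div_self hl.ne', mul_one, sub_self]
  | succ m hm ih =>
    rw [residual, eliminate, ih, pivotCol, pivotCol,
      (isPSDKernel_residual hR m).symm (pivotAt R l), ih]
    simp

lemma factor_pivotAt_eq_zero (hR : IsPSDKernel R) {l m : ℕ} (hl : HasPivotAt R l) (hlm : l < m) :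
    factor R m (pivotAt R l) = 0 := by
  rw [factor, pivotCol, (isPSDKernel_residual hR m).symm (pivotAt R l),
    residual_pivotAt hR hl hlm, zero_div]

/-- The number of elimination steps with a pivot is bounded by the rank of the kernel. -/
lemma HasPivotAt.succ_le_rank (hR : IsPSDKernel R) {m : ℕ} (h : HasPivotAt R m) :
    ∃ N : ℕ, m + 1 ≤ (Matrix.of fun i j : Fin N => R i j).rank := by
  obtain ⟨N, hN⟩ : ∃ N, ∀ s : Fin (m + 1), pivotAt R s < N :=
    ⟨Finset.univ.sup (fun s : Fin (m + 1) => pivotAt R s) + 1, fun s =>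
      Nat.lt_succ_of_le (Finset.le_sup (f := fun s : Fin (m + 1) => pivotAt R s)
        (Finset.mem_univ s))⟩
  have hp : ∀ s : Fin (m + 1), HasPivotAt R s := fun s => h.of_le (Nat.lt_succ_iff.1 s.2)
  -- Restricted to the pivots, the factor is lower triangular with positive diagonal, and the
  -- residual is gone after `m + 1` steps. So `C Cᵀ` is an invertible submatrix of the kernel.
  set C : Matrix (Fin (m + 1)) (Fin (m + 1)) ℝ := Matrix.of fun s l => factor R l (pivotAt R s)
    with hC
  have hdet : C.det ≠ 0 := by
    rw [Matrix.det_of_isLowerTriangular C (fun s l hsl => factor_pivotAt_eq_zero hR (hp s) hsl)]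
    refine Finset.prod_ne_zero_iff.2 fun s _ => ?_
    have : C s s = residual R s (pivotAt R s) (pivotAt R s)
      / √(residual R s (pivotAt R s) (pivotAt R s)) := rfl
    rw [this]
    exact div_ne_zero (hp s).ne' (Real.sqrt_pos.2 (hp s)).ne'
  set A : Matrix (Fin N) (Fin N) ℝ := Matrix.of fun i j => R i j with hA
  have hsub : A.submatrix (fun s : Fin (m + 1) => (⟨pivotAt R s, hN s⟩ : Fin N))
      (fun s : Fin (m + 1) => (⟨pivotAt R s, hN s⟩ : Fin N)) = C * C.transpose := by
    ext s t
    rw [Matrix.mul_apply, Matrix.submatrix_apply]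
    simp only [hA, hC, Matrix.of_apply, Matrix.transpose_apply]
    rw [eq_residual_add_sum (R := R) (m + 1), residual_pivotAt hR (hp t) t.2, zero_add,
      Fin.sum_univ_eq_sum_range (fun l => factor R l (pivotAt R s) * factor R l (pivotAt R t))]
  refine ⟨N, ?_⟩
  have h1 : (C * C.transpose).rank = m + 1 := by
    rw [Matrix.rank_of_isUnit, Fintype.card_fin]
    rw [Matrix.isUnit_iff_isUnit_det, Matrix.det_mul, Matrix.det_transpose]
    exact (mul_ne_zero hdet hdet).isUnit
  rw [← h1, ← hsub]
  exact Matrix.rank_submatrix_le _ _ _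

/-- Steps are counted from 0, so a pivot at step `m` would already force rank `m + 1`. -/
lemma factor_eq_zero (h : ∀ N : ℕ, (Matrix.of fun i j : Fin N => R i j).rank ≤ m)
    (hR : IsPSDKernel R) (i : ℕ) : factor R m i = 0 := by
  refine pivotCol_eq_zero (fun hp => ?_) i
  obtain ⟨N, hN⟩ := HasPivotAt.succ_le_rank hR (m := m) hp
  have := h N
  omega

lemma eq_sum_factor {p : ℕ} (h : ∀ N : ℕ, (Matrix.of fun i j : Fin N => R i j).rank ≤ p)
    (hR : IsPSDKernel R) (i j : ℕ) :
    R i j = ∑ l ∈ Finset.range p, factor R l i * factor R l j := by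
  rw [eq_residual_add_sum (R := R) p i j, eq_zero_of_no_pivot (isPSDKernel_residual hR p), zero_add]
  intro hp
  obtain ⟨N, hN⟩ := HasPivotAt.succ_le_rank hR (m := p) hp
  have := h N
  omega

section Measurable

variable {X : Type*} [MeasurableSpace X] {Z : X → ℕ → ℕ → ℝ}

/-- Taking the first index expresses the choice through countably many measurable conditions on the
diagonal. -/
lemma measurable_pivot (hZ : ∀ i j, Measurable fun x => Z x i j) :
    Measurable fun x => pivot (Z x) := by
  classical
  unfold pivot
  refine measurable_find (fun x => exists_pivot (Z x)) fun k => ?_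
  have hm : MeasurableSet {x | ∀ l, ¬ 0 < Z x l l} := by
    have : {x | ∀ l, ¬ 0 < Z x l l} = ⋂ l, {x | 0 < Z x l l}ᶜ := by ext; simp
    rw [this]
    exact MeasurableSet.iInter fun l => (measurableSet_lt measurable_const (hZ l l)).compl
  exact (measurableSet_lt measurable_const (hZ k k)).union hm

lemma measurable_pivotCol (hZ : ∀ i j, Measurable fun x => Z x i j) (i : ℕ) :
    Measurable fun x => pivotCol (Z x) i := by
  have hp := measurable_pivot hZ
  have h1 : Measurable fun x => Z x i (pivot (Z x)) :=
    (measurable_from_prod_countable_left (f := fun q : X × ℕ => Z q.1 i q.2)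
      fun k => hZ i k).comp (measurable_id.prodMk hp)
  have h2 : Measurable fun x => Z x (pivot (Z x)) (pivot (Z x)) :=
    (measurable_from_prod_countable_left (f := fun q : X × ℕ => Z q.1 q.2 q.2)
      fun k => hZ k k).comp (measurable_id.prodMk hp)
  exact h1.div h2.sqrt

lemma measurable_residual (hZ : ∀ i j, Measurable fun x => Z x i j) (m i j : ℕ) :
    Measurable fun x => residual (Z x) m i j := by
  induction m generalizing i j with
  | zero => exact hZ i j
  | succ m ih =>
    exact (ih i j).sub ((measurable_pivotCol ih i).mul (measurable_pivotCol ih j))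

lemma measurable_factor (hZ : ∀ i j, Measurable fun x => Z x i j) (m i : ℕ) :
    Measurable fun x => factor (Z x) m i :=
  measurable_pivotCol (measurable_residual hZ m) i

end Measurable

end Kernel

end

/-! ### Gram matrices and the main theorem -/

noncomputable section

namespace Kernel

/-- A Gram matrix of vectors in `ℝ^p` has rank at most `p`. -/
lemma rank_gram_le {N p : ℕ} (v : Fin N → EuclideanSpace ℝ (Fin p)) :
    (Matrix.of fun i j => inner ℝ (v i) (v j)).rank ≤ p := by
  set A : Matrix (Fin N) (Fin p) ℝ := Matrix.of fun i k => v i k with hA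
  have e : (Matrix.of fun i j => inner ℝ (v i) (v j)) = A * A.transpose := by
    ext i j
    rw [Matrix.mul_apply]
    simp [hA, PiLp.inner_apply, mul_comm]
  rw [e]
  refine (Matrix.rank_mul_le_left _ _).trans ((Matrix.rank_le_card_width A).trans ?_)
  simp

end Kernel

end

theorem proposition2p10 {K : Type*} [TopologicalSpace K] [LocallyCompactSpace K]
    [TopologicalSpace.SeparableSpace K] [TopologicalSpace.MetrizableSpace K]
    [MeasurableSpace K] [BorelSpace K]
    (μ : Measure K) [SigmaFinite μ] [μ.IsOpenPosMeasure]
    (E : RegularDirichletForm μ)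
    (ν : Measure K) (hν : E.IsMinimalEnergyDominant ν)
    (f : ℕ → E.domain) (hf : E.HasDenseSpan f)
    (Z : ℕ → ℕ → K → ℝ)
    (hZ : ∀ i j, ∀ᵐ x ∂ν, Z i j x = (E.mutualEnergyMeasure (f i) (f j)).rnDeriv ν x)
    (p : ℕ) :
    E.index ν ≤ (p : ℕ∞) ↔
      ∃ ζ : ℕ → K → EuclideanSpace ℝ (Fin p), (∀ i, Measurable (ζ i)) ∧
        ∀ᵐ x ∂ν, (∀ i j, Z i j x = inner ℝ (ζ i x) (ζ j x)) ∧
          ∀ (j : ℕ) (k : Fin p), E.pointwiseIndex ν x < ((k : ℕ) + 1 : ℕ∞) → ζ j x k = 0 := by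
  have : SecondCountableTopology K := by
    let := TopologicalSpace.metrizableSpaceMetric K
    exact UniformSpace.secondCountable_of_separable K
  have := hν.sigmaFinite
  have hdom := hν.domination
  have hidx := RegularDirichletForm.pointwiseIndex_ae_eq_rankSup hdom hf
  have hZ' : ∀ᵐ x ∂ν, ∀ i j, Z i j x = E.density ν (f i) (f j) x := by
    rw [ae_all_iff]; intro i
    rw [ae_all_iff]; exact hZ i
  rw [RegularDirichletForm.index_le_iff]
  constructor
  · intro hp
    set D : K → ℕ → ℕ → ℝ := fun x i j => E.density ν (f i) (f j) x with hD
    have hDm : ∀ i j, Measurable fun x => D x i j := fun i j => E.measurable_density ν _ _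
    refine ⟨fun i x => WithLp.toLp 2 fun k : Fin p => Kernel.factor (D x) k i, fun i => ?_, ?_⟩
    · exact (WithLp.measurable_toLp 2 (Fin p → ℝ)).comp
        (measurable_pi_lambda _ fun k => Kernel.measurable_factor hDm k i)
    filter_upwards [hp, hidx, hZ', RegularDirichletForm.ae_isPSDKernel_density hdom f]
      with x hpx hx hZx hPSD
    -- Used twice: with `m = p` for the factorization, and with `m = k` for the vanishing of
    -- coordinates beyond the pointwise index.
    have hrank : ∀ m : ℕ, E.pointwiseIndex ν x ≤ m →
        ∀ N : ℕ, (Matrix.of fun i j : Fin N => D x i j).rank ≤ m := by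
      intro m hm N
      rw [hx] at hm
      exact Nat.cast_le.1 ((le_iSup (fun N : ℕ =>
        ((Matrix.of fun i j : Fin N => D x i j).rank : ℕ∞)) N).trans hm)
    refine ⟨fun i j => ?_, fun j k hk => ?_⟩
    · rw [hZx]
      have h1 := Kernel.eq_sum_factor (hrank p hpx) hPSD i j
      change D x i j = _
      rw [h1, PiLp.inner_apply,
        ← Fin.sum_univ_eq_sum_range (fun l => Kernel.factor (D x) l i * Kernel.factor (D x) l j)]
      refine Finset.sum_congr rfl fun k _ => ?_
      simp [mul_comm]
    -- The coordinate `k : Fin p` is number `k + 1` in the statement, so the hypothesis says that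
    -- the pointwise index is at most `k`.
    · exact Kernel.factor_eq_zero (hrank k (Order.le_of_lt_add_one hk)) hPSD j
  · rintro ⟨ζ, -, hζ⟩
    filter_upwards [hζ, hidx, hZ'] with x hx hi hZx
    rw [hi]
    refine iSup_le fun N => Nat.cast_le.2 ?_
    have e : (Matrix.of fun i j : Fin N => E.density ν (f i) (f j) x)
        = Matrix.of fun i j : Fin N => inner ℝ (ζ i x) (ζ j x) := by
      ext i j
      rw [Matrix.of_apply, Matrix.of_apply, ← hZx, hx.1]
    rw [e]
    exact Kernel.rank_gram_le fun i : Fin N => ζ i x
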